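/- Let $\mathbf{k}$ be a field, $n\ge 0$, and let $W$ be a set of monomials $x_ix_j$ of length $2$ in $X=\{x_1,\dots,x_n\}$. Let $A^0=\mathbf{k}\langle x_1,\dots,x_n\rangle/(W)$, graded by length, $A^0=\bigoplus_{m\ge0}A^0_m$. Let $\Gamma_W$ be the directed graph with vertex set $X$ and an edge $x\to y$ iff $xy\in W$; let $N^\infty$ be the set of normal words, i.e. the words in $X$ in which no two consecutive letters form a monomial of $W$. The global dimension of $A^0$ is the least $d$ such that every ($\mathbb{Z}$-)graded $A^0$-module has a graded free resolution of length at most $d$ ($\infty$ if there is no such $d$); $A^0$ has polynomial growth if $m\mapsto\dim A^0_m$ is bounded by a polynomial in $m$, and polynomial growth of degree $d$ if $\sum_{i\le m}\dim A^0_i$ has the same order of growth as $m^d$ (that is, $\sum_{i\le m}\dim A^0_i=\Theta(m^d)$ as $m\to\infty$). The following conditions are equivalent. 1. $A^0$ has finite global dimension and polynomial growth. 2. $A^0$ has finite global dimension and $|W|=\binom n2$. 3. $A^0$ has polynomial growth, $W$ contains no monomial $xx$ with $x\in X$, and $|W|=\binom n2$. 4. $\Gamma_W$ is an acyclic tournament: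 it has no directed cycles (in particular no loops) and any two distinct vertices are joined by exactly one directed edge. 5. The Hilbert series is $H_{A^0}(z)=\sum_{m\ge0}(\dim A^0_m)z^m=\dfrac1{(1-z)^n}$. 6. There is a permutation $y_1,\dots,y_n$ of $x_1,\dots,x_n$ such that $N^\infty=\{y_1^{\alpha_1}\cdots y_n^{\alpha_n}\mid \alpha_i\ge0,\ 1\le i\le n\}$. 7. There is a permutation $y_1,\dots,y_n$ of $x_1,\dots,x_n$ such that $W=\{y_jy_i\mid 1\le i<j\le n\}$. Furthermore, in this case the global dimension of $A^0$ equals $n$, and $A^0$ has polynomial growth of degree $n$. -/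

import Mathlib

universe u

noncomputable section

namespace MonomialAlgebra

open scoped PowerSeries

/-! ### Graded modules, free resolutions, global dimension and growth of a graded algebra

`A` is a `k`-algebra and `𝒜 i` is its homogeneous component of degree `i`. -/

section Graded

variable {k A : Type u} [Field k] [Ring A] [Algebra k A]

/-- A `ℤ`-graded (left) module over the graded algebra `A = ⨁ 𝒜 i`. -/
structure GrMod (𝒜 : ℕ → Submodule k A) where
  /-- the underlying type -/
  carrier : Type u
  [addCommGroup : AddCommGroup carrier]
  [module : Module A carrier]
  /-- the homogeneous components -/
  deg : ℤ → AddSubgroup carrier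
  isInternal : DirectSum.IsInternal deg
  smul_mem : ∀ (i : ℕ) (j : ℤ) (a : A) (m : carrier),
    a ∈ 𝒜 i → m ∈ deg j → a • m ∈ deg ((i : ℤ) + j)

attribute [instance] GrMod.addCommGroup GrMod.module

variable {𝒜 : ℕ → Submodule k A}

/-- A graded module is (graded) free if it has an `A`-basis of homogeneous elements. -/
def GrMod.IsFree (M : GrMod 𝒜) : Prop :=
  ∃ (ι : Type u) (b : Module.Basis ι A M.carrier) (δ : ι → ℤ), ∀ i, b i ∈ M.deg (δ i)

/-- An `A`-linear map of graded modules is homogeneous (of degree `0`). -/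
def GrMod.IsHomogeneousMap {M N : GrMod 𝒜} (f : M.carrier →ₗ[A] N.carrier) : Prop :=
  ∀ (j : ℤ) (m : M.carrier), m ∈ M.deg j → f m ∈ N.deg j

/-- `M` has a free resolution of length at most `d`: an exact sequence
`0 → F d → ⋯ → F 1 → F 0 → M → 0` of graded free modules and homogeneous maps. -/
def GrMod.HasFreeResolutionOfLengthLE (M : GrMod 𝒜) (d : ℕ) : Prop :=
  ∃ (F : ℕ → GrMod 𝒜) (ε : (F 0).carrier →ₗ[A] M.carrier)
    (f : ∀ i, (F (i + 1)).carrier →ₗ[A] (F i).carrier),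
    (∀ i, (F i).IsFree) ∧
    GrMod.IsHomogeneousMap ε ∧ (∀ i, GrMod.IsHomogeneousMap (f i)) ∧
    Function.Surjective ε ∧ Function.Exact (f 0) ε ∧
    (∀ i, Function.Exact (f (i + 1)) (f i)) ∧
    (∀ i, d < i → Subsingleton (F i).carrier)

/-- The global dimension of the graded algebra `A = ⨁ 𝒜 i`: the least `d` such that each graded
`A`-module has a free resolution of length at most `d`, and `⊤` if there is no such `d`. -/
def globalDimension (𝒜 : ℕ → Submodule k A) : ℕ∞ :=
  ⨅ (d : ℕ) (_ : ∀ M : GrMod 𝒜, M.HasFreeResolutionOfLengthLE d), (d : ℕ∞)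

/-- Finite global dimension. -/
def HasFiniteGlobalDimension (𝒜 : ℕ → Submodule k A) : Prop :=
  globalDimension 𝒜 < ⊤

/-- Polynomial growth: `i ↦ dim A_i` is bounded by a polynomial in `i`. -/
def HasPolynomialGrowth (𝒜 : ℕ → Submodule k A) : Prop :=
  ∃ p : Polynomial ℝ, ∀ i : ℕ, (Module.finrank k (𝒜 i) : ℝ) ≤ p.eval (i : ℝ)

/-- Polynomial growth of degree `d`: the growth function `m ↦ dim (A_0 ⊕ ⋯ ⊕ A_m)` has the same
order of growth as `m ^ d`. -/
def HasPolynomialGrowthOfDegree (𝒜 : ℕ → Submodule k A) (d : ℕ) : Prop :=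
  Asymptotics.IsTheta Filter.atTop
    (fun m : ℕ => ∑ i ∈ Finset.range (m + 1), (Module.finrank k (𝒜 i) : ℝ))
    (fun m : ℕ => (m : ℝ) ^ d)

/-- The Hilbert series `∑ (dim A_i) z ^ i`. -/
def hilbertSeries (𝒜 : ℕ → Submodule k A) : ℚ⟦X⟧ :=
  PowerSeries.mk fun i => (Module.finrank k (𝒜 i) : ℚ)

end Graded

/-! ### Directed graphs -/

section Graph

variable {V : Type*}

/-- No cycles `v_0 → v_1 → ⋯ → v_k → v_0` with distinct vertices; the case `k = 0` is a loop. The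
addition `i + 1` in `Fin (k + 1)` is cyclic. -/
def IsAcyclic (G : Digraph V) : Prop :=
  ∀ (k : ℕ) (v : Fin (k + 1) → V), Function.Injective v → ¬ ∀ i, G.Adj (v i) (v (i + 1))

/-- A tournament: there are no loops, and any two distinct vertices are joined by exactly one
directed edge. -/
def IsTournament (G : Digraph V) : Prop :=
  (∀ x, ¬ G.Adj x x) ∧ ∀ x y, x ≠ y → Xor (G.Adj x y) (G.Adj y x)

end Graph

/-! ### Quadratic monomial algebras

The monomial `x_i x_j` of length two is encoded as the pair `(i, j)`. -/

section Monomial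

variable (k : Type u) [Field k] {n : ℕ} (W : Finset (Fin n × Fin n))

/-- The relations `x_i x_j = 0` for `x_i x_j` in `W`. -/
inductive Rel : FreeAlgebra k (Fin n) → FreeAlgebra k (Fin n) → Prop
  | of (p : Fin n × Fin n) (hp : p ∈ W) : Rel (FreeAlgebra.ι k p.1 * FreeAlgebra.ι k p.2) 0

/-- The quadratic monomial algebra `k⟨x_1, …, x_n⟩ / (W)`. -/
abbrev Alg : Type u := RingQuot (Rel k W)

/-- The image of the generator `x_i` in `k⟨x_1, …, x_n⟩ / (W)`. -/
def gen (i : Fin n) : Alg k W := RingQuot.mkAlgHom k (Rel k W) (FreeAlgebra.ι k i)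

/-- The homogeneous component of degree `m`, spanned by the words of length `m`. -/
def component (m : ℕ) : Submodule k (Alg k W) :=
  Submodule.span k {a | ∃ w : List (Fin n), w.length = m ∧ a = (w.map (gen k W)).prod}

/-- The graph `Γ_W`, with an edge `x → y` iff `xy` is in `W`. -/
def graph : Digraph (Fin n) where
  Adj x y := (x, y) ∈ W

/-- The set of normal words: no two consecutive letters form a monomial in `W`. -/
def normalWords : Set (FreeMonoid (Fin n)) :=
  {w | List.IsChain (fun x y => (x, y) ∉ W) (FreeMonoid.toList w)}

end Monomial

end MonomialAlgebra

end

/-! Everything is reduced to condition 7, in which `W` is a strict linear order read downwards. The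
normal words form a `k`-basis of the algebra (`normalBasis`), so dimensions count words avoiding
`W`. Dually, chains are words all of whose transitions lie in `W`, and they index a free resolution.

Growth: without loops in `W`, two distinct letters not joined by an edge, or a directed triangle in
`W`, give two different closed walks of length 3 at one vertex of the complementary graph, hence
exponentially many normal words (`eq_of_hasPolynomialGrowth`). Polynomial growth thus forces any two
letters to be joined.

Global dimension, lower bound: the trivial module has first syzygy the augmentation ideal, and the
left ideal `A x` has syzygy the left annihilator of `x`. Both retract onto `A y` for each letter `y`
they contain, so a walk with `d` edges forces projective dimension above `d`
(`not_walk_of_hasFreeResolution`), and finite global dimension excludes cycles.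

Global dimension, upper bound: every module `M` has the Koszul-type resolution with terms `A ⊗
(chains) ⊗ M`, exact by a homotopy that moves the last letter of a normal word into the chain. It
has length at most `d` when no chain has more than `d` letters
(`hasFreeResolution_of_chain_isEmpty`).

Hilbert series: the transition matrices for `W` and its complement sum to the all-ones matrix, which
has rank one, so the signed chain series inverts the Hilbert series (`chainSeries_mul`). The series
`(1 - z)^(-n)` then bounds the chains and fixes `|W|`.

What remains is finite combinatorics: acyclicity, totality and the edge count determine a linear
order, namely that of out-degrees (`exists_perm_of_tournament`). For such an order normal words are
sorted words and chains are strictly decreasing, which gives all the other conditions and the exact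
invariants. -/

noncomputable section

namespace MonomialAlgebra

/-! ### Normal words as a basis. -/

section NormalWords

variable (k : Type u) [Field k] {n : ℕ} (W : Finset (Fin n × Fin n))

/-- A list of letters is normal if no two consecutive letters form a monomial in `W`. -/
abbrev IsNormal (l : List (Fin n)) : Prop := l.IsChain fun x y => (x, y) ∉ W

/-- The type of normal words. -/
abbrev NormalList : Type := {l : List (Fin n) // IsNormal W l}

/-- The image of a word in the monomial algebra. -/
def word (l : List (Fin n)) : Alg k W := (l.map (gen k W)).prod

@[simp] lemma word_nil : word k W [] = 1 := rfl

@[simp] lemma word_cons (x : Fin n) (l : List (Fin n)) :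
    word k W (x :: l) = gen k W x * word k W l := by simp [word]

lemma word_append (l l' : List (Fin n)) :
    word k W (l ++ l') = word k W l * word k W l' := by simp [word]

lemma word_singleton (x : Fin n) : word k W [x] = gen k W x := by simp

variable {W}

lemma gen_mul_gen {x y : Fin n} (h : (x, y) ∈ W) : gen k W x * gen k W y = 0 := by
  have := RingQuot.mkAlgHom_rel k (Rel.of (k := k) (x, y) h)
  simpa [gen] using this

lemma word_eq_zero {l : List (Fin n)} (h : ¬ IsNormal W l) : word k W l = 0 := by
  rw [IsNormal, List.isChain_iff_forall_rel_of_append_cons_cons] at h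
  push Not at h
  obtain ⟨a, b, l₁, l₂, rfl, hab⟩ := h
  rw [word_append, word_cons, word_cons, ← mul_assoc (gen k W a), gen_mul_gen k hab]
  simp

variable (W)

/-- Left multiplication by a letter on the space of linear combinations of normal words. -/
def consOp (x : Fin n) : Module.End k (NormalList W →₀ k) :=
  Finsupp.lsum k fun u => if h : IsNormal W (x :: u.1) then Finsupp.lsingle ⟨x :: u.1, h⟩ else 0

lemma consOp_single (x : Fin n) (u : NormalList W) (h : IsNormal W (x :: u.1)) (c : k) :
    consOp k W x (Finsupp.single u c) = Finsupp.single ⟨x :: u.1, h⟩ c := by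
  simp [consOp, h]

lemma consOp_single_of_not (x : Fin n) (u : NormalList W) (h : ¬ IsNormal W (x :: u.1)) (c : k) :
    consOp k W x (Finsupp.single u c) = 0 := by
  simp [consOp, h]

/-- The representation of the monomial algebra on linear combinations of normal words. -/
def normalRep : Alg k W →ₐ[k] Module.End k (NormalList W →₀ k) :=
  RingQuot.liftAlgHom k ⟨FreeAlgebra.lift k (consOp k W), by
    rintro _ _ ⟨p, hp⟩
    simp only [map_mul, FreeAlgebra.lift_ι_apply, map_zero]
    ext u : 1
    refine LinearMap.ext fun c => ?_
    simp only [LinearMap.comp_apply, Finsupp.lsingle_apply, Module.End.mul_apply,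
      LinearMap.zero_apply]
    by_cases h : IsNormal W (p.2 :: u.1)
    · rw [consOp_single k W _ _ h, consOp_single_of_not]
      simp [IsNormal, hp]
    · rw [consOp_single_of_not k W _ _ h, map_zero]⟩

@[simp] lemma normalRep_gen (x : Fin n) : normalRep k W (gen k W x) = consOp k W x := by
  simp [normalRep, gen]

/-- A normal word acting on the empty word rebuilds itself letter by letter, since all its suffixes
are normal. This separates the normal words. -/
lemma normalRep_word (u : NormalList W) :
    normalRep k W (word k W u.1) (Finsupp.single ⟨[], List.isChain_nil⟩ 1) =
      Finsupp.single u 1 := by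
  obtain ⟨l, hl⟩ := u
  induction l with
  | nil => simp
  | cons x l ih =>
    have hl' : IsNormal W l := hl.tail
    simp only [word_cons, map_mul, Module.End.mul_apply, normalRep_gen]
    rw [ih hl', consOp_single k W x ⟨l, hl'⟩ hl]

lemma span_word : Submodule.span k (Set.range (word k W)) = ⊤ := by
  rw [eq_top_iff]
  rintro a -
  obtain ⟨a, rfl⟩ := RingQuot.mkAlgHom_surjective k (Rel k W) a
  induction a using FreeAlgebra.induction with
  | grade0 r =>
    rw [AlgHom.commutes, Algebra.algebraMap_eq_smul_one]
    exact Submodule.smul_mem _ _ (Submodule.subset_span ⟨[], rfl⟩)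
  | grade1 x => exact Submodule.subset_span ⟨[x], by simp [gen]⟩
  | mul a b ha hb =>
    rw [map_mul]
    have := Submodule.mul_mem_mul ha hb
    rw [Submodule.span_mul_span] at this
    refine Submodule.span_mono ?_ this
    rintro _ ⟨_, ⟨l, rfl⟩, _, ⟨l', rfl⟩, rfl⟩
    exact ⟨l ++ l', word_append k W l l'⟩
  | add a b ha hb => rw [map_add]; exact add_mem ha hb

/-- The normal words form a basis of the monomial algebra. -/
def normalBasis : Module.Basis (NormalList W) k (Alg k W) :=
  Module.Basis.mk (v := fun u : NormalList W => word k W u.1)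
    (by
      -- Acting on the empty word sends the family to the standard basis, so the family is
      -- independent.
      let φ : Alg k W →ₗ[k] (NormalList W →₀ k) :=
        (LinearMap.applyₗ (Finsupp.single ⟨[], List.isChain_nil⟩ (1 : k))).comp
          (normalRep k W).toLinearMap
      refine LinearIndependent.of_comp φ ?_
      have : φ ∘ (fun u : NormalList W => word k W u.1) = fun u => Finsupp.single u 1 :=
        funext fun u => normalRep_word k W u
      rw [this]
      exact Finsupp.linearIndependent_single_one k _)
    (by
      rw [← span_word, Submodule.span_le]
      rintro _ ⟨l, rfl⟩
      by_cases h : IsNormal W l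
      · exact Submodule.subset_span ⟨⟨l, h⟩, rfl⟩
      · rw [SetLike.mem_coe, word_eq_zero k h]; exact zero_mem _)

@[simp] lemma normalBasis_apply (u : NormalList W) : normalBasis k W u = word k W u.1 := by
  simp [normalBasis]

lemma normalBasis_repr_word (u : NormalList W) :
    (normalBasis k W).repr (word k W u.1) = Finsupp.single u 1 := by
  rw [← normalBasis_apply, Module.Basis.repr_self]

lemma word_mem_component (l : List (Fin n)) : word k W l ∈ component k W l.length :=
  Submodule.subset_span ⟨l, rfl, rfl⟩

/-- The number of normal words of length `m`. -/
def normalCount (m : ℕ) : ℕ := Nat.card {l : List (Fin n) // IsNormal W l ∧ l.length = m}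

lemma finrank_component (m : ℕ) : Module.finrank k (component k W m) = normalCount W m := by
  have hfin : Finite {l : List (Fin n) // IsNormal W l ∧ l.length = m} :=
    ((List.finite_length_eq (Fin n) m).subset fun l hl => hl.2).to_subtype
  let v : {l : List (Fin n) // IsNormal W l ∧ l.length = m} → Alg k W := fun u => word k W u.1
  have hv : LinearIndependent k v := by
    have := (normalBasis k W).linearIndependent.comp
      (fun u : {l : List (Fin n) // IsNormal W l ∧ l.length = m} =>
        (⟨u.1, u.2.1⟩ : NormalList W)) (fun a b h => by simpa [Subtype.ext_iff] using h)
    convert this using 1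
    ext u
    simp [v]
  have hs : component k W m = Submodule.span k (Set.range v) := by
    apply le_antisymm
    · rw [component, Submodule.span_le]
      rintro _ ⟨l, hl, rfl⟩
      by_cases h : IsNormal W l
      · exact Submodule.subset_span ⟨⟨l, h, hl⟩, rfl⟩
      · rw [SetLike.mem_coe]
        change word k W l ∈ _
        rw [word_eq_zero k h]
        exact zero_mem _
    · rw [Submodule.span_le]
      rintro _ ⟨⟨l, h, rfl⟩, rfl⟩
      exact word_mem_component k W l
  have := Fintype.ofFinite {l : List (Fin n) // IsNormal W l ∧ l.length = m}
  rw [hs, finrank_span_eq_card hv, normalCount, Nat.card_eq_fintype_card]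

end NormalWords

/-! ### Transfer matrices, Hilbert series and exponential growth. -/

section Counting

variable {n : ℕ} (W : Finset (Fin n × Fin n))

/-- The adjacency matrix of `Γ_W`. -/
def adjMat : Matrix (Fin n) (Fin n) ℚ := Matrix.of fun x y => if (x, y) ∈ W then 1 else 0

/-- The adjacency matrix of the complement of `Γ_W` (loops included). -/
def coadjMat : Matrix (Fin n) (Fin n) ℚ := Matrix.of fun x y => if (x, y) ∈ W then 0 else 1

/-- The number of words with `a` consecutive transitions outside `W` followed by `b`
transitions in `W`. -/
def mixedCount (a b : ℕ) : ℚ := ∑ x, ∑ y, (coadjMat W ^ a * adjMat W ^ b) x y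

lemma sum_sum_eq_dotProduct (M : Matrix (Fin n) (Fin n) ℚ) :
    ∑ x, ∑ y, M x y = (1 : Fin n → ℚ) ⬝ᵥ (M.mulVec 1) := by
  simp [dotProduct, Matrix.mulVec]

lemma coadjMat_add_adjMat :
    coadjMat W + adjMat W = Matrix.vecMulVec (1 : Fin n → ℚ) (1 : Fin n → ℚ) := by
  ext x y
  by_cases h : (x, y) ∈ W <;> simp [coadjMat, adjMat, h, Matrix.vecMulVec]

/-- Put a normal word with `a + 1` letters before a chain with `b + 1` letters: the junction is
either outside `W` or in `W`. In matrix terms, the all-ones matrix is a column times a row and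
splits the product. -/
lemma mixedCount_add (a b : ℕ) :
    mixedCount W (a + 1) b + mixedCount W a (b + 1) = mixedCount W a 0 * mixedCount W 0 b := by
  have h : coadjMat W ^ (a + 1) * adjMat W ^ b + coadjMat W ^ a * adjMat W ^ (b + 1) =
      coadjMat W ^ a * (Matrix.vecMulVec (1 : Fin n → ℚ) (1 : Fin n → ℚ)) * adjMat W ^ b := by
    rw [← coadjMat_add_adjMat, pow_succ, pow_succ']
    noncomm_ring
  simp only [mixedCount]
  simp only [← Finset.sum_add_distrib, ← Matrix.add_apply]
  rw [h, sum_sum_eq_dotProduct, sum_sum_eq_dotProduct, sum_sum_eq_dotProduct]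
  rw [← Matrix.mulVec_mulVec, ← Matrix.mulVec_mulVec, Matrix.vecMulVec_mulVec]
  simp [Matrix.mulVec_smul, mul_comm]

/-- Telescoping of `mixedCount_add`: each product is a sum of two neighbouring mixed counts with
total number of transitions `M`. -/
lemma alternating_sum_mixedCount (M t : ℕ) (ht : t ≤ M) :
    ∑ i ∈ Finset.range t, (-1) ^ i * mixedCount W 0 i * mixedCount W (M - 1 - i) 0 =
      mixedCount W M 0 - (-1) ^ t * mixedCount W (M - t) t := by
  induction t with
  | zero => simp
  | succ t ih =>
    rw [Finset.sum_range_succ, ih (by omega)]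
    have h := mixedCount_add W (M - 1 - t) t
    rw [show M - 1 - t + 1 = M - t by omega] at h
    rw [show M - (t + 1) = M - 1 - t by omega, pow_succ, mul_assoc ((-1) ^ t),
      mul_comm (mixedCount W 0 t), ← h]
    ring

/-- The number of normal words of length `m + 1` starting with a given letter. -/
def normalCountFrom (m : ℕ) (x : Fin n) : ℕ :=
  Nat.card {l : List (Fin n) // IsNormal W (x :: l) ∧ l.length = m}

lemma finite_normal (p : List (Fin n) → Prop) (m : ℕ) :
    Finite {l : List (Fin n) // p l ∧ l.length = m} :=
  ((List.finite_length_eq (Fin n) m).subset fun _ hl => hl.2).to_subtype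

lemma normalCountFrom_zero (x : Fin n) : normalCountFrom W 0 x = 1 := by
  rw [normalCountFrom, Nat.card_eq_one_iff_unique]
  refine ⟨⟨?_⟩, ⟨[], by simp⟩⟩
  rintro ⟨a, -, ha⟩ ⟨b, -, hb⟩
  rw [List.length_eq_zero_iff] at ha hb
  subst ha hb
  rfl

lemma normalCountFrom_succ (m : ℕ) (x : Fin n) :
    normalCountFrom W (m + 1) x =
      ∑ y, if (x, y) ∈ W then 0 else normalCountFrom W m y := by
  have e : {l : List (Fin n) // IsNormal W (x :: l) ∧ l.length = m + 1} ≃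
      Σ y : {y // (x, y) ∉ W}, {l : List (Fin n) // IsNormal W (y.1 :: l) ∧ l.length = m} :=
    { toFun := fun l => match l with
        | ⟨[], h⟩ => absurd h.2 (by simp)
        | ⟨y :: l, h⟩ => ⟨⟨y, (List.isChain_cons_cons.1 h.1).1⟩,
            ⟨l, (List.isChain_cons_cons.1 h.1).2, by simpa using h.2⟩⟩
      invFun := fun p => ⟨p.1.1 :: p.2.1,
        List.isChain_cons_cons.2 ⟨p.1.2, p.2.2.1⟩, by simp [p.2.2.2]⟩
      left_inv := by
        rintro ⟨l, h⟩
        cases l with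
        | nil => exact absurd h.2 (by simp)
        | cons y l => rfl
      right_inv := fun _ => rfl }
  have := fun y : {y // (x, y) ∉ W} => finite_normal (fun l => IsNormal W (y.1 :: l)) m
  rw [normalCountFrom, Nat.card_congr e, Nat.card_sigma, Finset.sum_ite, Finset.sum_const_zero,
    zero_add, Finset.sum_subtype (p := fun y => (x, y) ∉ W) _ (by simp)
      (fun y => normalCountFrom W m y)]
  rfl

lemma normalCountFrom_eq (m : ℕ) (x : Fin n) :
    (normalCountFrom W m x : ℚ) = ∑ y, (coadjMat W ^ m) x y := by
  induction m generalizing x with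
  | zero => simp [normalCountFrom_zero, Matrix.one_apply]
  | succ m ih =>
    rw [normalCountFrom_succ, pow_succ']
    simp only [Matrix.mul_apply]
    rw [Finset.sum_comm]
    push_cast
    refine Finset.sum_congr rfl fun y _ => ?_
    rw [← Finset.mul_sum, ← ih]
    simp [coadjMat]

lemma normalCount_zero : normalCount W 0 = 1 := by
  rw [normalCount, Nat.card_eq_one_iff_unique]
  refine ⟨⟨?_⟩, ⟨[], by simp⟩⟩
  rintro ⟨a, -, ha⟩ ⟨b, -, hb⟩
  rw [List.length_eq_zero_iff] at ha hb
  subst ha hb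
  rfl

lemma normalCount_succ (m : ℕ) : (normalCount W (m + 1) : ℚ) = mixedCount W m 0 := by
  have e : {l : List (Fin n) // IsNormal W l ∧ l.length = m + 1} ≃
      Σ y : Fin n, {l : List (Fin n) // IsNormal W (y :: l) ∧ l.length = m} :=
    { toFun := fun l => match l with
        | ⟨[], h⟩ => absurd h.2 (by simp)
        | ⟨y :: l, h⟩ => ⟨y, ⟨l, h.1, by simpa using h.2⟩⟩
      invFun := fun p => ⟨p.1 :: p.2.1, p.2.2.1, by simp [p.2.2.2]⟩
      left_inv := by
        rintro ⟨l, h⟩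
        cases l with
        | nil => exact absurd h.2 (by simp)
        | cons y l => rfl
      right_inv := fun _ => rfl }
  have := fun y : Fin n => finite_normal (fun l => IsNormal W (y :: l)) m
  rw [normalCount, Nat.card_congr e, Nat.card_sigma, mixedCount]
  push_cast
  simp only [pow_zero, mul_one]
  exact Finset.sum_congr rfl fun x _ => normalCountFrom_eq W m x

/-- The signed generating function of the chains of `Γ_W`. -/
def chainSeries : PowerSeries ℚ :=
  PowerSeries.mk fun j => j.casesOn 1 fun i => (-1) ^ (i + 1) * mixedCount W 0 i

/-- The Koszul duality relation between Hilbert series, obtained here by counting alone. -/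
lemma chainSeries_mul :
    chainSeries W * PowerSeries.mk (fun i => (normalCount W i : ℚ)) = 1 := by
  ext m
  rw [PowerSeries.coeff_mul]
  cases m with
  | zero => simp [chainSeries, normalCount_zero]
  | succ M =>
    rw [Finset.Nat.sum_antidiagonal_eq_sum_range_succ_mk, Finset.sum_range_succ',
      Finset.sum_range_succ]
    simp only [chainSeries, PowerSeries.coeff_mk, normalCount_zero, Nat.sub_zero, Nat.sub_self,
      PowerSeries.coeff_one, normalCount_succ]
    -- The two boundary terms left by the telescoping cancel the first and last terms of the
    -- convolution.
    have h := alternating_sum_mixedCount W M M le_rfl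
    have h' : ∑ i ∈ Finset.range M, (-1) ^ (i + 1) * mixedCount W 0 i *
        (normalCount W (M + 1 - (i + 1)) : ℚ) =
        - ∑ i ∈ Finset.range M, (-1) ^ i * mixedCount W 0 i * mixedCount W (M - 1 - i) 0 := by
      rw [← Finset.sum_neg_distrib]
      refine Finset.sum_congr rfl fun i hi => ?_
      rw [Finset.mem_range] at hi
      rw [show M + 1 - (i + 1) = (M - 1 - i) + 1 by omega, normalCount_succ]
      ring
    rw [h', h]
    simp
    ring

lemma coeff_one_sub_X_pow_eq_zero (n m : ℕ) (h : n < m) :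
    PowerSeries.coeff m ((1 - PowerSeries.X : PowerSeries ℚ) ^ n) = 0 := by
  induction n generalizing m with
  | zero => simp [PowerSeries.coeff_one]; omega
  | succ n ih =>
    cases m with
    | zero => omega
    | succ m =>
      rw [pow_succ, mul_sub, mul_one, map_sub, PowerSeries.coeff_succ_mul_X, ih _ (by omega),
        ih _ (by omega), sub_zero]

lemma coeff_two_one_sub_X_pow (n : ℕ) :
    PowerSeries.coeff 0 ((1 - PowerSeries.X : PowerSeries ℚ) ^ n) = 1 ∧
    PowerSeries.coeff 1 ((1 - PowerSeries.X : PowerSeries ℚ) ^ n) = -n ∧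
    PowerSeries.coeff 2 ((1 - PowerSeries.X : PowerSeries ℚ) ^ n) = n.choose 2 := by
  induction n with
  | zero => simp [PowerSeries.coeff_one]
  | succ n ih =>
    obtain ⟨h0, h1, h2⟩ := ih
    rw [pow_succ, mul_sub, mul_one]
    refine ⟨?_, ?_, ?_⟩
    · simp
    · rw [map_sub, h1, show (1 : ℕ) = 0 + 1 from rfl, PowerSeries.coeff_succ_mul_X, h0]
      push_cast; ring
    · rw [map_sub, h2, show (2 : ℕ) = 1 + 1 from rfl, PowerSeries.coeff_succ_mul_X, h1,
        Nat.choose_succ_succ n 1]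
      push_cast; simp; ring

lemma one_sub_X_pow_mul_inv (n : ℕ) :
    ((1 - PowerSeries.X : PowerSeries ℚ) ^ n) * ((1 - PowerSeries.X : PowerSeries ℚ) ^ n)⁻¹ = 1 :=
  PowerSeries.mul_inv_cancel _ (by simp)

lemma mixedCount_zero_one : mixedCount W 0 1 = W.card := by
  simp only [mixedCount, adjMat, pow_zero, pow_one, one_mul, Matrix.of_apply]
  rw [← Fintype.sum_prod_type' (f := fun x y => if (x, y) ∈ W then (1 : ℚ) else 0)]
  simp

/-- The chain series must be `(1 - z)^n`. Its coefficient at `n + 1` counts, up to sign, chains with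
`n` transitions; its coefficient at `2` counts `W`. -/
lemma mixedCount_of_hilbert
    (h : PowerSeries.mk (fun i => (normalCount W i : ℚ)) =
      ((1 - PowerSeries.X : PowerSeries ℚ) ^ n)⁻¹) :
    mixedCount W 0 n = 0 ∧ W.card = n.choose 2 := by
  have hc : chainSeries W = (1 - PowerSeries.X : PowerSeries ℚ) ^ n := by
    have h1 := chainSeries_mul W
    rw [h] at h1
    calc chainSeries W = chainSeries W * (((1 - PowerSeries.X : PowerSeries ℚ) ^ n)⁻¹ *
          (1 - PowerSeries.X : PowerSeries ℚ) ^ n) := by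
            rw [mul_comm _ ((1 - PowerSeries.X : PowerSeries ℚ) ^ n), one_sub_X_pow_mul_inv,
              mul_one]
      _ = _ := by rw [← mul_assoc, h1, one_mul]
  constructor
  · have := coeff_one_sub_X_pow_eq_zero n (n + 1) (Nat.lt_succ_self n)
    rw [← hc, chainSeries, PowerSeries.coeff_mk] at this
    simpa using this
  · have := (coeff_two_one_sub_X_pow n).2.2
    rw [← hc, chainSeries, PowerSeries.coeff_mk] at this
    change (-1) ^ (1 + 1) * mixedCount W 0 1 = _ at this
    rw [mixedCount_zero_one] at this
    norm_num at this
    exact_mod_cast this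

lemma adjMat_pow_nonneg (m : ℕ) (x y : Fin n) : 0 ≤ (adjMat W ^ m) x y := by
  induction m generalizing x y with
  | zero => rw [pow_zero, Matrix.one_apply]; split_ifs <;> simp
  | succ m ih =>
    rw [pow_succ, Matrix.mul_apply]
    refine Finset.sum_nonneg fun z _ => mul_nonneg (ih _ _) ?_
    simp only [adjMat, Matrix.of_apply]; split_ifs <;> simp

lemma coadjMat_pow_nonneg (m : ℕ) (x y : Fin n) : 0 ≤ (coadjMat W ^ m) x y := by
  induction m generalizing x y with
  | zero => rw [pow_zero, Matrix.one_apply]; split_ifs <;> simp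
  | succ m ih =>
    rw [pow_succ, Matrix.mul_apply]
    refine Finset.sum_nonneg fun z _ => mul_nonneg (ih _ _) ?_
    simp only [coadjMat, Matrix.of_apply]; split_ifs <;> simp

lemma adjMat_pow_pos (w : ℕ → Fin n) (hw : ∀ i, (w i, w (i + 1)) ∈ W) (m : ℕ) :
    0 < (adjMat W ^ m) (w 0) (w m) := by
  induction m with
  | zero => simp
  | succ m ih =>
    rw [pow_succ, Matrix.mul_apply]
    refine lt_of_lt_of_le ?_ (Finset.single_le_sum (f := fun z =>
      (adjMat W ^ m) (w 0) z * adjMat W z (w (m + 1))) (fun z _ => mul_nonneg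
      (adjMat_pow_nonneg W m _ _) ?_) (Finset.mem_univ (w m)))
    · simpa [adjMat, hw m] using ih
    · simp only [adjMat, Matrix.of_apply]; split_ifs <;> simp

/-- A sum of nonnegative entries vanishes only if each entry does, whereas the first `m` steps of a
walk make one entry positive. -/
lemma not_walk_of_mixedCount_eq_zero {m : ℕ} (h : mixedCount W 0 m = 0)
    (w : ℕ → Fin n) : ¬ ∀ i, (w i, w (i + 1)) ∈ W := by
  intro hw
  have h1 := adjMat_pow_pos W w hw m
  simp only [mixedCount, pow_zero, one_mul] at h
  rw [Finset.sum_eq_zero_iff_of_nonneg fun x _ =>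
    Finset.sum_nonneg fun y _ => adjMat_pow_nonneg W m x y] at h
  have h2 := h (w 0) (Finset.mem_univ _)
  rw [Finset.sum_eq_zero_iff_of_nonneg fun y _ => adjMat_pow_nonneg W m _ y] at h2
  exact h1.ne' (h2 _ (Finset.mem_univ _))

/-- The closed walks `x x x x` and `x y z x` in the complement are distinct and have the same length
3, so they can be concatenated freely at `x`. -/
lemma two_pow_le_normalCount {x y z : Fin n} (hxx : (x, x) ∉ W) (hxy : (x, y) ∉ W)
    (hyz : (y, z) ∉ W) (hzx : (z, x) ∉ W) (hne : (y, z) ≠ (x, x)) (m : ℕ) :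
    2 ^ m ≤ normalCount W (3 * m + 1) := by
  have h3 : 2 ≤ (coadjMat W ^ 3) x x := by
    have e : (coadjMat W ^ 3) x x =
        ∑ p : Fin n × Fin n, coadjMat W x p.1 * coadjMat W p.1 p.2 * coadjMat W p.2 x := by
      rw [pow_succ, pow_two, Matrix.mul_apply, Fintype.sum_prod_type, Finset.sum_comm]
      refine Finset.sum_congr rfl fun b _ => ?_
      rw [Matrix.mul_apply, Finset.sum_mul]
    rw [e]
    -- Only the two walks through `(y, z)` and `(x, x)` are kept from the sum over intermediate
    -- vertices.
    refine le_trans ?_ (Finset.sum_le_sum_of_subset_of_nonneg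
      (Finset.subset_univ {(y, z), (x, x)}) fun p _ _ => ?_)
    · rw [Finset.sum_pair hne]
      simp [coadjMat, hxx, hxy, hyz, hzx]
      norm_num
    · simp only [coadjMat, Matrix.of_apply]; split_ifs <;> simp
  have hpow : (2 : ℚ) ^ m ≤ (coadjMat W ^ (3 * m)) x x := by
    induction m with
    | zero => simp
    | succ m ih =>
      rw [show 3 * (m + 1) = 3 * m + 3 by ring, pow_add (coadjMat W), Matrix.mul_apply,
        pow_succ (2 : ℚ)]
      refine le_trans (mul_le_mul ih h3 (by norm_num) (coadjMat_pow_nonneg W _ _ _)) ?_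
      exact Finset.single_le_sum (f := fun z => (coadjMat W ^ (3 * m)) x z *
        (coadjMat W ^ 3) z x) (fun z _ => mul_nonneg (coadjMat_pow_nonneg W _ _ _)
        (coadjMat_pow_nonneg W _ _ _)) (Finset.mem_univ x)
  have : (2 : ℚ) ^ m ≤ normalCount W (3 * m + 1) := by
    rw [normalCount_succ, mixedCount]
    simp only [pow_zero, mul_one]
    refine hpow.trans (le_trans ?_ (Finset.single_le_sum (f := fun x => ∑ y,
      (coadjMat W ^ (3 * m)) x y) (fun x _ => Finset.sum_nonneg fun y _ =>
      coadjMat_pow_nonneg W _ _ _) (Finset.mem_univ x)))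
    exact Finset.single_le_sum (f := fun y => (coadjMat W ^ (3 * m)) x y)
      (fun y _ => coadjMat_pow_nonneg W _ _ _) (Finset.mem_univ x)
  exact_mod_cast this

/-- After substitution the bound is again polynomial in `m`, hence negligible against `2 ^ m`, which
would make `2 ^ m` negligible against itself. -/
lemma not_two_pow_le_polynomial (p : Polynomial ℝ) :
    ¬ ∀ m : ℕ, (2 : ℝ) ^ m ≤ p.eval ((3 * m + 1 : ℕ) : ℝ) := by
  intro h
  let q : Polynomial ℝ := p.comp (3 * Polynomial.X + 1)
  have hq : ∀ m : ℕ, p.eval ((3 * m + 1 : ℕ) : ℝ) = q.eval (m : ℝ) := by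
    intro m; simp [q]
  have hlo : (fun m : ℕ => q.eval (m : ℝ)) =o[Filter.atTop] fun m : ℕ => (2 : ℝ) ^ m := by
    simp only [Polynomial.eval_eq_sum_range]
    refine Asymptotics.IsLittleO.fun_sum (E' := ℝ) (F' := ℝ) fun i _ => ?_
    exact (isLittleO_pow_const_const_pow_of_one_lt (R := ℝ) i
      (by norm_num : (1 : ℝ) < 2)).const_mul_left _
  have hself : (fun m : ℕ => (2 : ℝ) ^ m) =o[Filter.atTop] fun m : ℕ => (2 : ℝ) ^ m := by
    refine Asymptotics.IsBigO.trans_isLittleO (g := fun m : ℕ => q.eval (m : ℝ)) ?_ hlo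
    refine Asymptotics.IsBigO.of_bound 1 (Filter.Eventually.of_forall fun m => ?_)
    have := h m
    rw [hq] at this
    rw [one_mul, Real.norm_of_nonneg (by positivity)]
    exact this.trans (le_abs_self _)
  have := Asymptotics.isLittleO_irrefl (f'' := fun m : ℕ => (2 : ℝ) ^ m) (l := Filter.atTop)
    (Filter.Frequently.of_forall fun m => by positivity)
  exact this hself

variable (k : Type u) [Field k]

/-- Used twice: with `z = y` for a pair not joined by an edge, and with three letters for a reversed
triangle of `W`. -/
lemma eq_of_hasPolynomialGrowth (h : HasPolynomialGrowth (component k W)) {x y z : Fin n}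
    (hxx : (x, x) ∉ W) (hxy : (x, y) ∉ W) (hyz : (y, z) ∉ W) (hzx : (z, x) ∉ W) :
    y = x ∧ z = x := by
  by_contra hne
  obtain ⟨p, hp⟩ := h
  refine not_two_pow_le_polynomial p fun m => ?_
  have h1 := two_pow_le_normalCount W hxx hxy hyz hzx (by simpa using hne) m
  have h2 := hp (3 * m + 1)
  rw [finrank_component] at h2
  exact le_trans (by exact_mod_cast h1) h2

end Counting

/-! ### Tournaments, linear orders and sorted words. -/

section Combinatorics

variable {n : ℕ} {W : Finset (Fin n × Fin n)}

/-- Going round a cycle forever, with indices modulo its length, is an infinite walk. -/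
lemma isAcyclic_of_no_walk (h : ∀ w : ℕ → Fin n, ¬ ∀ i, (w i, w (i + 1)) ∈ W) :
    IsAcyclic (graph W) := by
  intro k v _ hv
  refine h (fun i => v (Fin.ofNat (k + 1) i)) fun i => ?_
  have := hv (Fin.ofNat (k + 1) i)
  have e : (Fin.ofNat (k + 1) i) + 1 = Fin.ofNat (k + 1) (i + 1) := by
    apply Fin.ext
    simp [Fin.ofNat, Fin.val_add]
  rw [e] at this
  exact this

lemma IsAcyclic.irrefl (h : IsAcyclic (graph W)) (x : Fin n) : (x, x) ∉ W := by
  intro hx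
  exact h 0 (fun _ => x) (fun a b _ => Fin.ext (by omega)) fun _ => hx

lemma IsAcyclic.asymm (h : IsAcyclic (graph W)) {x y : Fin n} (hxy : (x, y) ∈ W) :
    (y, x) ∉ W := by
  intro hyx
  have hne : x ≠ y := by rintro rfl; exact h.irrefl x hxy
  refine h 1 ![x, y] ?_ ?_
  · intro a b hab
    fin_cases a <;> fin_cases b <;> simp_all
  · intro i
    fin_cases i
    · exact hxy
    · exact hyx

lemma IsAcyclic.no_triangle (h : IsAcyclic (graph W)) {x y z : Fin n} (hxy : (x, y) ∈ W)
    (hyz : (y, z) ∈ W) : (z, x) ∉ W := by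
  intro hzx
  have h1 : x ≠ y := by rintro rfl; exact h.irrefl x hxy
  have h2 : y ≠ z := by rintro rfl; exact h.irrefl y hyz
  have h3 : z ≠ x := by rintro rfl; exact h.irrefl z hzx
  refine h 2 ![x, y, z] ?_ ?_
  · intro a b hab
    fin_cases a <;> fin_cases b <;> simp_all
  · intro i
    fin_cases i
    · exact hxy
    · exact hyz
    · exact hzx

variable (W) in
/-- The unordered pairs underlying the edges of `Γ_W`. -/
def edgeSym2 : Finset (Sym2 (Fin n)) := W.image fun p => s(p.1, p.2)

lemma card_filter_not_isDiag :
    (Finset.univ.filter fun e : Sym2 (Fin n) => ¬ e.IsDiag).card = n.choose 2 := by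
  have := Sym2.card_subtype_not_diag (α := Fin n)
  rw [Fintype.card_fin] at this
  rw [← this, Fintype.card_subtype]

/-- Asymmetry makes forgetting the orientation injective, so by cardinality every off-diagonal pair
is reached. -/
lemma total_of_card (hirr : ∀ x, (x, x) ∉ W) (hasymm : ∀ x y, (x, y) ∈ W → (y, x) ∉ W)
    (hcard : W.card = n.choose 2) {x y : Fin n} (hne : x ≠ y) : (x, y) ∈ W ∨ (y, x) ∈ W := by
  have hsub : edgeSym2 W ⊆ Finset.univ.filter fun e : Sym2 (Fin n) => ¬ e.IsDiag := by
    intro e he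
    obtain ⟨⟨a, b⟩, hp, rfl⟩ := Finset.mem_image.1 he
    simp only [Finset.mem_filter, Finset.mem_univ, true_and, Sym2.mk_isDiag_iff]
    rintro rfl
    exact hirr _ hp
  have hc : (edgeSym2 W).card = W.card := by
    refine Finset.card_image_of_injOn ?_
    rintro ⟨a, b⟩ hab ⟨c, d⟩ hcd h
    rcases Sym2.eq_iff.1 h with ⟨rfl, rfl⟩ | ⟨rfl, rfl⟩
    · rfl
    · exact absurd hcd (hasymm _ _ hab)
  have heq := Finset.eq_of_subset_of_card_le hsub (by rw [hc, hcard, card_filter_not_isDiag])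
  have hxy : s(x, y) ∈ edgeSym2 W := by rw [heq]; simpa using hne
  obtain ⟨⟨a, b⟩, hp, h⟩ := Finset.mem_image.1 hxy
  rcases Sym2.eq_iff.1 h with ⟨rfl, rfl⟩ | ⟨rfl, rfl⟩
  · exact Or.inl hp
  · exact Or.inr hp

/-- The converse count: totality makes forgetting the orientation cover all off-diagonal pairs, and
equal cardinalities then force injectivity. -/
lemma asymm_of_card (hirr : ∀ x, (x, x) ∉ W)
    (htot : ∀ x y, x ≠ y → (x, y) ∈ W ∨ (y, x) ∈ W)
    (hcard : W.card = n.choose 2) {x y : Fin n} (hxy : (x, y) ∈ W) : (y, x) ∉ W := by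
  intro hyx
  have hsub : (Finset.univ.filter fun e : Sym2 (Fin n) => ¬ e.IsDiag) ⊆ edgeSym2 W := by
    intro e he
    induction e with
    | _ a b =>
      rcases htot a b (by simpa using he) with h | h
      · exact Finset.mem_image.2 ⟨_, h, rfl⟩
      · exact Finset.mem_image.2 ⟨_, h, Sym2.eq_swap⟩
  have hc : (edgeSym2 W).card = W.card := by
    refine le_antisymm Finset.card_image_le ?_
    rw [hcard, ← card_filter_not_isDiag]
    exact Finset.card_le_card hsub
  have hinj := Finset.card_image_iff.1 hc
  have := hinj hxy hyx Sym2.eq_swap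
  simp only [Prod.mk.injEq] at this
  obtain ⟨rfl, -⟩ := this
  exact hirr _ hxy

/-- Letters are ranked by out-degree. Excluding 3-cycles is enough: in a tournament it gives
transitivity, so out-degrees drop strictly along edges and are pairwise distinct. -/
lemma exists_perm_of_tournament (hirr : ∀ x, (x, x) ∉ W)
    (hasymm : ∀ x y, (x, y) ∈ W → (y, x) ∉ W)
    (htot : ∀ x y, x ≠ y → (x, y) ∈ W ∨ (y, x) ∈ W)
    (htri : ∀ x y z, (x, y) ∈ W → (y, z) ∈ W → (z, x) ∉ W) :
    ∃ y : Equiv.Perm (Fin n), (W : Set (Fin n × Fin n)) =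
      {p | ∃ i j : Fin n, i < j ∧ p = (y j, y i)} := by
  -- The out-degree is below `n` because `x` is not its own successor.
  let r : Fin n → Fin n := fun x => ⟨(Finset.univ.filter fun z => (x, z) ∈ W).card, by
    have : (Finset.univ.filter fun z => (x, z) ∈ W) ⊂ Finset.univ := by
      rw [Finset.ssubset_univ_iff]
      intro h
      have := Finset.mem_univ x
      rw [← h] at this
      exact hirr x (by simpa using this)
    simpa using Finset.card_lt_card this⟩
  have hr : ∀ x y, (x, y) ∈ W → r y < r x := by
    intro x y hxy
    change (Finset.univ.filter fun z => (y, z) ∈ W).card <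
      (Finset.univ.filter fun z => (x, z) ∈ W).card
    refine Finset.card_lt_card ⟨fun z hz => ?_, fun h => ?_⟩
    · simp only [Finset.mem_filter, Finset.mem_univ, true_and] at hz ⊢
      have hne : x ≠ z := by rintro rfl; exact hasymm _ _ hxy hz
      exact (htot x z hne).resolve_right (htri x y z hxy hz)
    · have : y ∈ (Finset.univ.filter fun z => (y, z) ∈ W) := h (by simpa using hxy)
      exact hirr y (by simpa using this)
  have hinj : Function.Injective r := by
    intro x y h
    by_contra hne
    rcases htot x y hne with h' | h'
    · exact (hr _ _ h').ne h.symm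
    · exact (hr _ _ h').ne h
  let e : Equiv.Perm (Fin n) := Equiv.ofBijective r (Finite.injective_iff_bijective.1 hinj)
  have he : ∀ i, r (e.symm i) = i := fun i => e.apply_symm_apply i
  refine ⟨e.symm, Set.ext fun p => ⟨fun hp => ⟨r p.2, r p.1, hr _ _ hp, ?_⟩, ?_⟩⟩
  · exact Prod.ext (e.symm_apply_apply p.1).symm (e.symm_apply_apply p.2).symm
  · rintro ⟨i, j, hij, rfl⟩
    have hne : e.symm j ≠ e.symm i := fun h => hij.ne' (e.symm.injective h)
    refine (htot _ _ hne).resolve_right fun h => ?_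
    have := hr _ _ h
    rw [he, he] at this
    exact lt_asymm hij this

section Ordered

variable {y : Equiv.Perm (Fin n)}
  (hy : (W : Set (Fin n × Fin n)) = {p | ∃ i j : Fin n, i < j ∧ p = (y j, y i)})

include hy

lemma mem_iff_of_eq (a b : Fin n) : (a, b) ∈ W ↔ y.symm b < y.symm a := by
  rw [← Finset.mem_coe, hy]
  constructor
  · rintro ⟨i, j, hij, h⟩
    simp only [Prod.mk.injEq] at h
    obtain ⟨rfl, rfl⟩ := h
    simpa using hij
  · intro h
    exact ⟨_, _, h, by simp⟩

lemma isTournament_of_eq : IsTournament (graph W) := by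
  constructor
  · intro x hx
    exact lt_irrefl _ ((mem_iff_of_eq hy x x).1 hx)
  · intro a b hab
    change Xor ((a, b) ∈ W) ((b, a) ∈ W)
    rw [mem_iff_of_eq hy, mem_iff_of_eq hy]
    rcases lt_or_gt_of_ne (fun h => hab (y.symm.injective h)) with h | h
    · exact Or.inr ⟨h, h.asymm⟩
    · exact Or.inl ⟨h, h.asymm⟩

lemma isAcyclic_of_eq : IsAcyclic (graph W) := by
  refine isAcyclic_of_no_walk fun w hw => ?_
  have : StrictAnti fun i => y.symm (w i) :=
    strictAnti_nat_of_succ_lt fun i => (mem_iff_of_eq hy _ _).1 (hw i)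
  exact not_injective_infinite_finite _ this.injective

lemma card_of_eq : W.card = n.choose 2 := by
  have hT := isTournament_of_eq hy
  have hA := isAcyclic_of_eq hy
  rw [← card_filter_not_isDiag]
  have hc : (edgeSym2 W).card = W.card := by
    refine Finset.card_image_of_injOn ?_
    rintro ⟨a, b⟩ hab ⟨c, d⟩ hcd h
    rcases Sym2.eq_iff.1 h with ⟨rfl, rfl⟩ | ⟨rfl, rfl⟩
    · rfl
    · exact absurd hcd (hA.asymm hab)
  rw [← hc]
  congr 1
  ext e
  induction e with
  | _ a b =>
    simp only [edgeSym2, Finset.mem_image, Finset.mem_filter, Finset.mem_univ, true_and,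
      Sym2.mk_isDiag_iff]
    constructor
    · rintro ⟨⟨c, d⟩, hp, h⟩ rfl
      rcases Sym2.eq_iff.1 h with ⟨rfl, h⟩ | ⟨rfl, h⟩ <;>
      · simp only at h
        subst h
        exact hA.irrefl _ hp
    · intro h
      rcases (hT.2 a b h).or with h | h
      · exact ⟨(a, b), h, rfl⟩
      · exact ⟨(b, a), h, Sym2.eq_swap⟩

end Ordered

/-- The word `y_1 ^ α_1 ⋯ y_n ^ α_n` as a list. -/
def powerWord (y : Equiv.Perm (Fin n)) (α : Fin n → ℕ) : List (Fin n) :=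
  (List.ofFn fun i => List.replicate (α i) (y i)).flatten

lemma toList_prod_ofFn (y : Equiv.Perm (Fin n)) (α : Fin n → ℕ) :
    FreeMonoid.toList (List.ofFn fun i => FreeMonoid.of (y i) ^ α i).prod = powerWord y α := by
  rw [FreeMonoid.toList_prod, powerWord, List.map_ofFn]
  congr 2
  ext1 i
  simp only [Function.comp_apply]
  induction α i with
  | zero => rfl
  | succ m ih => rw [pow_succ', FreeMonoid.toList_mul, ih]; rfl

lemma length_powerWord (y : Equiv.Perm (Fin n)) (α : Fin n → ℕ) :
    (powerWord y α).length = ∑ i, α i := by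
  rw [powerWord, List.length_flatten, List.map_ofFn, List.sum_ofFn]
  simp

lemma count_powerWord (y : Equiv.Perm (Fin n)) (α : Fin n → ℕ) (j : Fin n) :
    (powerWord y α).count (y j) = α j := by
  rw [powerWord, List.count_flatten, List.map_ofFn, List.sum_ofFn]
  simp [List.count_replicate]

/-- Normal words are those weakly increasing in the order of the `y i`, and a sorted word is
determined by its letter multiplicities. -/
lemma normalWords_eq_of_eq {y : Equiv.Perm (Fin n)}
    (hy : (W : Set (Fin n × Fin n)) = {p | ∃ i j : Fin n, i < j ∧ p = (y j, y i)}) :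
    normalWords W =
      {w | ∃ α : Fin n → ℕ, w = (List.ofFn fun i => FreeMonoid.of (y i) ^ α i).prod} := by
  have hR : ∀ a b, (a, b) ∉ W ↔ y.symm a ≤ y.symm b := fun a b => by
    rw [mem_iff_of_eq hy, not_lt]
  -- Transitivity upgrades the condition on consecutive letters to one on all pairs.
  have : Trans (fun a b : Fin n => (a, b) ∉ W) (fun a b : Fin n => (a, b) ∉ W)
      (fun a b : Fin n => (a, b) ∉ W) :=
    ⟨fun h h' => (hR _ _).2 (((hR _ _).1 h).trans ((hR _ _).1 h'))⟩
  have hpw : ∀ α, (powerWord y α).Pairwise fun a b => (a, b) ∉ W := by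
    intro α
    rw [powerWord, List.pairwise_flatten]
    constructor
    · intro l hl
      obtain ⟨i, rfl⟩ := (List.mem_ofFn' _ _).1 hl
      simp [List.pairwise_replicate, hR]
    · rw [List.pairwise_ofFn]
      intro i j hij a ha b hb
      rw [List.eq_of_mem_replicate ha, List.eq_of_mem_replicate hb, hR]
      simpa using hij.le
  ext w
  simp only [normalWords, Set.mem_ofPred_eq]
  constructor
  · intro hw
    refine ⟨fun i => (FreeMonoid.toList w).count (y i), FreeMonoid.toList.injective ?_⟩
    rw [toList_prod_ofFn]
    refine List.Perm.eq_of_pairwise ?_ hw.pairwise (hpw _) ?_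
    · intro a b _ _ h h'
      exact y.symm.injective (le_antisymm ((hR _ _).1 h) ((hR _ _).1 h'))
    · rw [List.perm_iff_count]
      intro a
      obtain ⟨i, rfl⟩ := y.surjective a
      rw [count_powerWord]
  · rintro ⟨α, rfl⟩
    rw [toList_prod_ofFn]
    exact (hpw α).isChain

/-- Exponent vectors of sum `m` parametrize the normal words of length `m`; injectivity holds
because letter counts recover the exponents. -/
lemma normalCount_eq_multichoose {y : Equiv.Perm (Fin n)}
    (h : normalWords W =
      {w | ∃ α : Fin n → ℕ, w = (List.ofFn fun i => FreeMonoid.of (y i) ^ α i).prod}) (m : ℕ) :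
    normalCount W m = n.multichoose m := by
  have hn : ∀ l : List (Fin n), IsNormal W l ↔ ∃ α, l = powerWord y α := by
    intro l
    have := Set.ext_iff.1 h (FreeMonoid.ofList l)
    simp only [normalWords, Set.mem_ofPred_eq, FreeMonoid.toList_ofList] at this
    rw [IsNormal, this]
    refine exists_congr fun α => ?_
    rw [← toList_prod_ofFn]
    rfl
  have hcard := Finset.card_finsuppAntidiag_nat_eq_multichoose
    (s := (Finset.univ : Finset (Fin n))) m
  rw [Finset.card_univ, Fintype.card_fin] at hcard
  rw [← hcard, ← Nat.card_eq_finsetCard, normalCount]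
  symm
  refine Nat.card_eq_of_bijective
    (fun f : (Finset.univ : Finset (Fin n)).finsuppAntidiag m =>
      (⟨powerWord y f.1, (hn _).2 ⟨_, rfl⟩, ?_⟩ :
        {l : List (Fin n) // IsNormal W l ∧ l.length = m})) ⟨?_, ?_⟩
  · rw [length_powerWord]
    exact (Finset.mem_finsuppAntidiag.1 f.2).1
  · intro f g hfg
    refine Subtype.ext (Finsupp.ext fun i => ?_)
    rw [← count_powerWord y f.1, ← count_powerWord y g.1]
    exact congrArg (List.count (y i)) (congrArg Subtype.val hfg)
  · rintro ⟨l, hl, hm⟩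
    obtain ⟨α, rfl⟩ := (hn l).1 hl
    rw [length_powerWord] at hm
    exact ⟨⟨Finsupp.equivFunOnFinite.symm α, by simp [hm]⟩, rfl⟩

lemma mk_multichoose (n : ℕ) :
    (PowerSeries.mk fun i => (n.multichoose i : ℚ)) =
      ((1 - PowerSeries.X : PowerSeries ℚ) ^ n)⁻¹ := by
  rw [PowerSeries.eq_inv_iff_mul_eq_one (by simp)]
  cases n with
  | zero =>
    ext i
    cases i <;> simp [PowerSeries.coeff_one]
  | succ d =>
    refine Eq.trans ?_ (PowerSeries.mk_add_choose_mul_one_sub_pow_eq_one ℚ d)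
    congr 2
    ext i
    rw [Nat.multichoose_eq, show d + 1 + i - 1 = d + i by omega, Nat.choose_symm_add]

end Combinatorics

/-! ### The length filtration and the projections onto the left ideals of letters. -/

section WordSpan

variable (k : Type u) [Field k] {n : ℕ} (W : Finset (Fin n × Fin n))

/-- The span of the words of length at least `m`. -/
def wordSpan (m : ℕ) : Submodule k (Alg k W) :=
  Submodule.span k {a | ∃ l : List (Fin n), m ≤ l.length ∧ a = word k W l}

variable {k W}

lemma wordSpan_mul {p q : ℕ} {a b : Alg k W} (ha : a ∈ wordSpan k W p)
    (hb : b ∈ wordSpan k W q) : a * b ∈ wordSpan k W (p + q) := by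
  have := Submodule.mul_mem_mul ha hb
  rw [wordSpan, wordSpan, Submodule.span_mul_span] at this
  refine Submodule.span_mono ?_ this
  rintro _ ⟨_, ⟨l, hl, rfl⟩, _, ⟨l', hl', rfl⟩, rfl⟩
  exact ⟨l ++ l', by simp; omega, (word_append k W l l').symm⟩

lemma repr_eq_zero_of_mem_wordSpan {m : ℕ} {a : Alg k W} (ha : a ∈ wordSpan k W m)
    (u : NormalList W) (hu : u.1.length < m) : (normalBasis k W).repr a u = 0 := by
  induction ha using Submodule.span_induction with
  | mem a ha =>
    obtain ⟨l, hl, rfl⟩ := ha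
    by_cases h : IsNormal W l
    · rw [normalBasis_repr_word k W ⟨l, h⟩, Finsupp.single_apply, if_neg]
      rintro rfl
      exact absurd hl (by simpa using hu)
    · simp [word_eq_zero k h]
  | zero => simp
  | add a b _ _ ha hb => simp [ha, hb]
  | smul c a _ ha => simp [ha]

lemma mem_wordSpan_of_repr {m : ℕ} {a : Alg k W}
    (h : ∀ u : NormalList W, u.1.length < m → (normalBasis k W).repr a u = 0) :
    a ∈ wordSpan k W m := by
  rw [← (normalBasis k W).linearCombination_repr a, Finsupp.linearCombination_apply]
  refine Submodule.sum_mem _ fun u hu => Submodule.smul_mem _ _ ?_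
  rw [normalBasis_apply]
  refine Submodule.subset_span ⟨u.1, ?_, rfl⟩
  by_contra hlt
  exact Finsupp.mem_support_iff.1 hu (h u (not_le.1 hlt))

/-- The element equals all its powers, so it lies in every step of the length filtration, whose
intersection is zero. -/
lemma eq_zero_of_idempotent {e : Alg k W} (he : e ∈ wordSpan k W 1) (hee : e * e = e) :
    e = 0 := by
  have h : ∀ m, e ∈ wordSpan k W (m + 1) := by
    intro m
    induction m with
    | zero => exact he
    | succ m ih => rw [← hee]; exact wordSpan_mul ih he
  refine (normalBasis k W).ext_elem fun u => ?_
  rw [map_zero, repr_eq_zero_of_mem_wordSpan (h u.1.length) u (Nat.lt_succ_self _)]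
  rfl

lemma gen_ne_zero (y : Fin n) : gen k W y ≠ 0 := by
  have := (normalBasis k W).ne_zero (⟨[y], List.isChain_singleton y⟩ : NormalList W)
  simpa using this

variable (k W) in
/-- The projection onto the span of the words ending in the letter `y`. -/
def lastProj (y : Fin n) : Alg k W →ₗ[k] Alg k W :=
  (normalBasis k W).constr k fun u => if u.1.getLast? = some y then word k W u.1 else 0

lemma lastProj_word (y : Fin n) (l : List (Fin n)) :
    lastProj k W y (word k W l) = if l.getLast? = some y then word k W l else 0 := by
  by_cases h : IsNormal W l
  · have := (normalBasis k W).constr_basis k (fun u : NormalList W =>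
      if u.1.getLast? = some y then word k W u.1 else 0) ⟨l, h⟩
    rw [normalBasis_apply] at this
    exact this
  · simp [word_eq_zero k h]

/-- Left multiplication does not change the last letter of a nonempty word. For `b = 1` this fails,
whence the restriction to positive length. -/
lemma lastProj_mul (y : Fin n) (a : Alg k W) {b : Alg k W} (hb : b ∈ wordSpan k W 1) :
    lastProj k W y (a * b) = a * lastProj k W y b := by
  have ha : a ∈ Submodule.span k (Set.range (word k W)) := by rw [span_word]; trivial
  induction hb using Submodule.span_induction with
  | mem b hb =>
    obtain ⟨l', hl', rfl⟩ := hb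
    induction ha using Submodule.span_induction with
    | mem a ha =>
      obtain ⟨l, rfl⟩ := ha
      have hne : l' ≠ [] := by rintro rfl; simp at hl'
      rw [← word_append, lastProj_word, lastProj_word, List.getLast?_append_of_ne_nil _ hne]
      split_ifs
      · rw [word_append]
      · simp
    | zero => simp
    | add a b _ _ ha hb => simp [add_mul, ha, hb]
    | smul c a _ ha => simp [ha]
  | zero => simp
  | add a b _ _ ha hb => simp [mul_add, ha, hb]
  | smul c a _ ha => simp [ha]

variable (k W) in
/-- The left ideal generated by the letter `y`. -/
def genIdeal (y : Fin n) : Submodule (Alg k W) (Alg k W) :=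
  LinearMap.range (LinearMap.toSpanSingleton (Alg k W) (Alg k W) (gen k W y))

lemma mul_gen_mem_genIdeal (y : Fin n) (a : Alg k W) : a * gen k W y ∈ genIdeal k W y :=
  ⟨a, rfl⟩

lemma lastProj_mem (y : Fin n) (a : Alg k W) : lastProj k W y a ∈ genIdeal k W y := by
  have ha : a ∈ Submodule.span k (Set.range (word k W)) := by rw [span_word]; trivial
  induction ha using Submodule.span_induction with
  | mem a ha =>
    obtain ⟨l, rfl⟩ := ha
    rw [lastProj_word]
    split_ifs with h
    · obtain ⟨l', rfl⟩ := List.getLast?_eq_some_iff.1 h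
      rw [word_append, word_singleton]
      exact mul_gen_mem_genIdeal y _
    · exact zero_mem _
  | zero => simp
  | add a b _ _ ha hb => rw [map_add]; exact add_mem ha hb
  | smul c a _ ha =>
    rw [map_smul, ← algebraMap_smul (Alg k W) c]
    exact Submodule.smul_mem _ _ ha

lemma lastProj_mul_gen (y : Fin n) (a : Alg k W) :
    lastProj k W y (a * gen k W y) = a * gen k W y := by
  rw [lastProj_mul, ← word_singleton, lastProj_word]
  · simp
  · exact Submodule.subset_span ⟨[y], by simp, by simp⟩

end WordSpan

/-! ### Syzygies of cyclic modules. -/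

section ProjectiveDimension

open CategoryTheory

/-- Dimension shifting bounds the kernel, and projective dimension does not increase on a retract.
-/
lemma hasProjectiveDimensionLT_of_retract_ker {A : Type u} [Ring A] {M : Type u} [AddCommGroup M]
    [Module A M] (f : A →ₗ[A] M) (hf : Function.Surjective f) (I : Submodule A A)
    (hi : I ≤ LinearMap.ker f) (r : LinearMap.ker f →ₗ[A] I)
    (hr : ∀ x : I, r (Submodule.inclusion hi x) = x) (e : ℕ)
    (h : HasProjectiveDimensionLT (ModuleCat.of A M) (e + 2)) :
    HasProjectiveDimensionLT (ModuleCat.of A I) (e + 1) := by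
  have hSE := LinearMap.shortExact_shortComplexKer hf
  have hproj : Projective f.shortComplexKer.X₂ :=
    (IsProjective.iff_projective (R := A) A).1 inferInstance
  have h1 : HasProjectiveDimensionLT f.shortComplexKer.X₁ (e + 1) :=
    (hSE.hasProjectiveDimensionLT_X₃_iff e hproj).1 h
  let R : Retract (ModuleCat.of A I) f.shortComplexKer.X₁ :=
    { i := ModuleCat.ofHom (Submodule.inclusion hi)
      r := ModuleCat.ofHom r
      retract := by ext x; exact congrArg _ (hr x) }
  exact R.hasProjectiveDimensionLT (e + 1)

variable {k : Type u} [Field k] {n : ℕ} {W : Finset (Fin n × Fin n)}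
  {M : Type u} [AddCommGroup M] [Module (Alg k W) M] (f : Alg k W →ₗ[Alg k W] M)
  (hf : Function.Surjective f) (hker : ∀ a, f a = 0 → a ∈ wordSpan k W 1)
  {y : Fin n} (hy : f (gen k W y) = 0)

include hf hker hy

/-- For a section `s`, the element `1 - s (f 1)` is an idempotent in the kernel acting on it as a
right identity. It must be zero, yet it fixes the nonzero letter `y`. -/
lemma not_projective_of_gen_mem_ker : ¬ Module.Projective (Alg k W) M := by
  intro hM
  obtain ⟨s, hs⟩ := Module.projective_lifting_property f LinearMap.id hf
  have hs' : ∀ m, f (s m) = m := fun m => LinearMap.congr_fun hs m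
  have hmul : ∀ a, f a = 0 → a * (1 - s (f 1)) = a := by
    intro a ha
    have h1 : a * s (f 1) = s (f a) := by
      rw [← smul_eq_mul, ← map_smul, ← map_smul, smul_eq_mul, mul_one]
    rw [mul_sub, mul_one, h1, ha, map_zero, sub_zero]
  have he : f (1 - s (f 1)) = 0 := by rw [map_sub, hs', sub_self]
  have h0 := eq_zero_of_idempotent (hker _ he) (hmul _ he)
  have := hmul _ hy
  rw [h0, mul_zero] at this
  exact gen_ne_zero y this.symm

/-- `lastProj` is linear on the kernel, which has no constant terms, and retracts it onto the left
ideal of `y`. -/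
lemma hasProjectiveDimensionLT_genIdeal (e : ℕ)
    (h : HasProjectiveDimensionLT (ModuleCat.of (Alg k W) M) (e + 2)) :
    HasProjectiveDimensionLT (ModuleCat.of (Alg k W) (genIdeal k W y)) (e + 1) := by
  have hi : genIdeal k W y ≤ LinearMap.ker f := by
    rintro _ ⟨a, rfl⟩
    rw [LinearMap.mem_ker, LinearMap.toSpanSingleton_apply, map_smul, hy, smul_zero]
  let r : LinearMap.ker f →ₗ[Alg k W] genIdeal k W y :=
    { toFun := fun a => ⟨lastProj k W y a.1, lastProj_mem y a.1⟩
      map_add' := fun a b => Subtype.ext (by simp)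
      map_smul' := fun c a => Subtype.ext (lastProj_mul y c (hker _ a.2)) }
  refine hasProjectiveDimensionLT_of_retract_ker f hf (genIdeal k W y) hi r ?_ e h
  rintro ⟨_, a, rfl⟩
  exact Subtype.ext (lastProj_mul_gen y a)

end ProjectiveDimension

/-! ### Walks bound the projective dimension from below. -/

section LowerBound

open CategoryTheory

variable {k : Type u} [Field k] {n : ℕ} {W : Finset (Fin n × Fin n)}

variable (k W) in
/-- Right multiplication by the letter `x`, as a map onto the left ideal it generates. -/
def mulGen (x : Fin n) : Alg k W →ₗ[Alg k W] genIdeal k W x :=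
  (LinearMap.toSpanSingleton (Alg k W) (Alg k W) (gen k W x)).rangeRestrict

/-- The constant coefficient of `a` reappears as the coefficient of the word `x` in `a * x`. -/
lemma mem_wordSpan_of_mul_gen_eq_zero (x : Fin n) (a : Alg k W) (h : a * gen k W x = 0) :
    a ∈ wordSpan k W 1 := by
  have key : ∀ a : Alg k W, (normalBasis k W).repr (a * gen k W x)
      ⟨[x], List.isChain_singleton x⟩ = (normalBasis k W).repr a ⟨[], List.isChain_nil⟩ := by
    intro a
    have ha : a ∈ Submodule.span k (Set.range (word k W)) := by rw [span_word]; trivial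
    induction ha using Submodule.span_induction with
    | mem a ha =>
      obtain ⟨l, rfl⟩ := ha
      rcases l with _ | ⟨z, l⟩
      · have h1 := normalBasis_repr_word k W ⟨[x], List.isChain_singleton x⟩
        have h2 := normalBasis_repr_word k W ⟨[], List.isChain_nil⟩
        simp only [word_nil, one_mul, word_cons, mul_one] at h1 h2 ⊢
        rw [h1, h2]
        simp
      · rw [← word_singleton k W x, ← word_append]
        rw [repr_eq_zero_of_mem_wordSpan (m := 2) (Submodule.subset_span ⟨_, by simp, rfl⟩)
          _ (by simp), repr_eq_zero_of_mem_wordSpan (m := 1)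
          (Submodule.subset_span ⟨_, by simp, rfl⟩) _ (by simp)]
    | zero => simp
    | add a b _ _ ha hb => simp [add_mul, ha, hb]
    | smul c a _ ha => simp [ha]
  refine mem_wordSpan_of_repr fun u hu => ?_
  obtain ⟨l, hl⟩ := u
  obtain rfl : l = [] := by simpa using hu
  rw [← key, h]
  simp

lemma mulGen_eq_zero_iff (x : Fin n) (a : Alg k W) : mulGen k W x a = 0 ↔ a * gen k W x = 0 := by
  rw [mulGen, Subtype.ext_iff]
  rfl

/-- Each edge into the current letter puts its source in the annihilator and lowers the dimension
bound by one; at dimension zero one further edge contradicts projectivity. -/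
lemma not_walk_of_hasProjectiveDimensionLT (e : ℕ) (x : Fin n)
    (h : HasProjectiveDimensionLT (ModuleCat.of (Alg k W) (genIdeal k W x)) (e + 1))
    (w : ℕ → Fin n) (hw0 : w 0 = x) : ¬ ∀ i ≤ e, (w (i + 1), w i) ∈ W := by
  intro hw
  have hsurj : Function.Surjective (mulGen k W x) := LinearMap.surjective_rangeRestrict _
  have hker : ∀ a, mulGen k W x a = 0 → a ∈ wordSpan k W 1 := fun a ha =>
    mem_wordSpan_of_mul_gen_eq_zero x a ((mulGen_eq_zero_iff x a).1 ha)
  have hy : mulGen k W x (gen k W (w 1)) = 0 := by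
    rw [mulGen_eq_zero_iff]
    exact gen_mul_gen k (by simpa [hw0] using hw 0 (Nat.zero_le _))
  induction e generalizing x w with
  | zero =>
    refine not_projective_of_gen_mem_ker (M := genIdeal k W x) (mulGen k W x) hsurj hker hy ?_
    exact (IsProjective.iff_projective (R := Alg k W) _).2
      (projective_iff_hasProjectiveDimensionLT_one.2 h)
  | succ e ih =>
    have h1 := hasProjectiveDimensionLT_genIdeal (M := genIdeal k W x) (mulGen k W x) hsurj hker
      hy e h
    refine ih (w 1) h1 (fun i => w (i + 1)) rfl (fun i hi => hw (i + 1) (by omega))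
      (LinearMap.surjective_rangeRestrict _) (fun a ha =>
      mem_wordSpan_of_mul_gen_eq_zero _ a ((mulGen_eq_zero_iff _ a).1 ha)) ?_
    rw [mulGen_eq_zero_iff]
    exact gen_mul_gen k (hw 1 (by omega))

/-- Induction on `d` by dimension shifting: dropping the zeroth term leaves a resolution of
`LinearMap.ker ε`. -/
theorem hasProjectiveDimensionLT_of_resolution {A : Type u} [Ring A] (d : ℕ)
    (M : ModuleCat.{u} A) (F : ℕ → ModuleCat.{u} A) (ε : F 0 →ₗ[A] M)
    (f : ∀ i, F (i + 1) →ₗ[A] F i) (hF : ∀ i, Module.Projective A (F i))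
    (hε : Function.Surjective ε) (h0 : Function.Exact (f 0) ε)
    (hex : ∀ i, Function.Exact (f (i + 1)) (f i))
    (hd : ∀ i, d < i → Subsingleton (F i)) :
    HasProjectiveDimensionLT M (d + 1) := by
  have hP : ∀ i, Projective (F i) := fun i => (IsProjective.iff_projective (R := A) (F i)).1 (hF i)
  have hSE := LinearMap.shortExact_shortComplexKer hε
  let g : F 1 →ₗ[A] LinearMap.ker ε :=
    (f 0).codRestrict _ fun x => (h0 _).2 ⟨x, rfl⟩
  have hg : Function.Surjective g := by
    rintro ⟨x, hx⟩
    obtain ⟨z, hz⟩ := (h0 x).1 hx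
    exact ⟨z, Subtype.ext hz⟩
  have h2 : HasProjectiveDimensionLT (ModuleCat.of A (F 0)) (d + 1) :=
    have : Projective (ModuleCat.of A (F 0)) := hP 0
    hasProjectiveDimensionLT_of_ge _ 1 _ (by omega)
  refine hSE.hasProjectiveDimensionLT_X₃ d ?_ h2
  cases d with
  | zero =>
    refine Limits.IsZero.hasProjectiveDimensionLT_zero ?_
    have := hd 1 one_pos
    have := hg.subsingleton
    exact ModuleCat.isZero_of_subsingleton _
  | succ d =>
    refine hasProjectiveDimensionLT_of_resolution d (ModuleCat.of A (LinearMap.ker ε))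
      (fun i => F (i + 1)) g (fun i => f (i + 1))
      (fun i => hF _) hg ?_ (fun i => hex _) (fun i hi => hd _ (by omega))
    intro x
    rw [← hex 0 x, Subtype.ext_iff]
    rfl

variable (k W) in
/-- The augmentation of the monomial algebra. -/
def augmentation : Alg k W →ₐ[k] k :=
  RingQuot.liftAlgHom k ⟨FreeAlgebra.lift k (fun _ => (0 : k)), by
    rintro _ _ ⟨p, hp⟩
    simp⟩

@[simp] lemma augmentation_gen (x : Fin n) : augmentation k W (gen k W x) = 0 := by
  simp [augmentation, gen]

end LowerBound

/-! ### The Koszul-type resolution of an arbitrary module. -/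

section Resolution

open TensorProduct

variable {k : Type u} [Field k] {n : ℕ} {W : Finset (Fin n × Fin n)}

variable (W) in
/-- The chains of length `i`: the words in which all consecutive letters form monomials in `W`. -/
@[ext]
structure Chain (i : ℕ) : Type where
  /-- the letters of a chain -/
  letter : Fin i → Fin n
  mem : ∀ a b : Fin i, (a : ℕ) + 1 = b → (letter a, letter b) ∈ W

namespace Chain

/-- Deletion of the first letter. -/
def tail {i : ℕ} (w : Chain W (i + 1)) : Chain W i :=
  ⟨fun j => w.letter j.succ, fun _ _ h => w.mem _ _ (by simp [h])⟩

/-- Deletion of the last letter. -/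
def init {i : ℕ} (w : Chain W (i + 1)) : Chain W i :=
  ⟨fun j => w.letter j.castSucc, fun _ _ h => w.mem _ _ (by simp [h])⟩

/-- Insertion of a letter at the front. -/
def cons {i : ℕ} (x : Fin n) (w : Chain W (i + 1)) (h : (x, w.letter 0) ∈ W) : Chain W (i + 2) :=
  ⟨Fin.cons x w.letter, fun a b hab => by
    obtain ⟨b, rfl⟩ := Fin.exists_succ_eq.2 (show b ≠ 0 by rintro rfl; simp at hab)
    rw [Fin.cons_succ]
    cases a using Fin.cases with
    | zero =>
      have : b = 0 := by apply Fin.ext; simpa using hab.symm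
      rw [this]; exact h
    | succ a =>
      rw [Fin.cons_succ]
      exact w.mem _ _ (by simpa using hab)⟩

/-- A chain consisting of one letter. -/
def single (x : Fin n) : Chain W 1 := ⟨fun _ => x, fun _ _ h => by omega⟩

instance : Unique (Chain W 0) where
  default := ⟨Fin.elim0, fun a => a.elim0⟩
  uniq _ := Chain.ext (funext fun j => j.elim0)

lemma cons_tail {i : ℕ} (w : Chain W (i + 2)) (h : (w.letter 0, w.tail.letter 0) ∈ W) :
    cons (w.letter 0) w.tail h = w :=
  Chain.ext (Fin.cons_self_tail w.letter)

lemma tail_cons {i : ℕ} (x : Fin n) (w : Chain W (i + 1)) (h : (x, w.letter 0) ∈ W) :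
    (cons x w h).tail = w :=
  Chain.ext (funext fun j => by simp [cons, tail])

lemma init_cons {i : ℕ} (x : Fin n) (w : Chain W (i + 2)) (h : (x, w.letter 0) ∈ W) :
    (cons x w h).init = cons x w.init h :=
  Chain.ext (funext fun j => by
    cases j using Fin.cases with
    | zero => rfl
    | succ j => rfl)

lemma init_cons_one (x : Fin n) (w : Chain W 1) (h : (x, w.letter 0) ∈ W) :
    (cons x w h).init = single x :=
  Chain.ext (funext fun j => by
    obtain rfl : j = 0 := Subsingleton.elim _ _
    rfl)

lemma single_apply_zero (w : Chain W 1) : single (w.letter 0) = w :=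
  Chain.ext (funext fun j => by
    obtain rfl : j = 0 := Subsingleton.elim _ _
    rfl)

lemma cons_zero {i : ℕ} (x : Fin n) (w : Chain W (i + 1)) (h : (x, w.letter 0) ∈ W) :
    (cons x w h).letter 0 = x := rfl

lemma cons_last {i : ℕ} (x : Fin n) (w : Chain W (i + 1)) (h : (x, w.letter 0) ∈ W) :
    (cons x w h).letter (Fin.last (i + 1)) = w.letter (Fin.last i) := rfl

lemma tail_init {i : ℕ} (w : Chain W (i + 2)) : w.init.tail = w.tail.init := rfl

lemma mem_zero {i : ℕ} (w : Chain W (i + 2)) : (w.letter 0, w.tail.letter 0) ∈ W :=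
  w.mem _ _ (by simp)

lemma mem_last {i : ℕ} (w : Chain W (i + 2)) :
    (w.init.letter (Fin.last i), w.letter (Fin.last (i + 1))) ∈ W :=
  w.mem _ _ (by simp)

end Chain

variable (k W) in
/-- The terms of the resolution of a left module `M`. -/
abbrev ResTerm (M : Type u) [AddCommGroup M] [Module k M] (i : ℕ) : Type u :=
  Alg k W ⊗[k] (Chain W i →₀ M)

/-- Extension of scalars for a `k`-linear map into an `A`-module. -/
def extendScalars {A V N : Type*} [Semiring A] [Algebra k A] [AddCommMonoid V] [Module k V]
    [AddCommMonoid N] [Module k N] [Module A N] [IsScalarTower k A N] (φ : V →ₗ[k] N) :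
    A ⊗[k] V →ₗ[A] N :=
  { TensorProduct.lift ((Algebra.lsmul k k N).toLinearMap.compl₂ φ) with
    map_smul' := fun a x => by
      induction x with
      | zero => simp
      | add x y hx hy => simp_all
      | tmul b v => simp [TensorProduct.smul_tmul'] }

@[simp] lemma extendScalars_tmul {A V N : Type*} [Semiring A] [Algebra k A] [AddCommMonoid V]
    [Module k V] [AddCommMonoid N] [Module k N] [Module A N] [IsScalarTower k A N]
    (φ : V →ₗ[k] N) (a : A) (v : V) : extendScalars φ (a ⊗ₜ v) = a • φ v := rfl

variable {M : Type u} [AddCommGroup M] [Module k M]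

@[elab_as_elim]
-- Scalars are absorbed into `m`, so no hypothesis on scalar multiplication is needed.
lemma resTerm_induction {i : ℕ} {p : ResTerm k W M i → Prop}
    (add : ∀ x y, p x → p y → p (x + y)) (zero : p 0)
    (word : ∀ (u : List (Fin n)), IsNormal W u → ∀ (w : Chain W i) (m : M),
      p (MonomialAlgebra.word k W u ⊗ₜ Finsupp.single w m)) (x : ResTerm k W M i) : p x := by
  induction x using TensorProduct.induction_on with
  | zero => exact zero
  | add x y hx hy => exact add x y hx hy
  | tmul a v =>
    induction v using Finsupp.induction_linear with
    | zero => simpa using zero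
    | add v v' hv hv' => rw [TensorProduct.tmul_add]; exact add _ _ hv hv'
    | single w m =>
      have ha : a ∈ Submodule.span k (Set.range (normalBasis k W)) := by
        rw [(normalBasis k W).span_eq]; trivial
      induction ha using Submodule.span_induction generalizing m with
      | mem a ha =>
        obtain ⟨u, rfl⟩ := ha
        rw [normalBasis_apply]
        exact word u.1 u.2 w m
      | zero => simpa using zero
      | add a b _ _ ha hb => rw [TensorProduct.add_tmul]; exact add _ _ (ha m) (hb m)
      | smul c a _ ha =>
        rw [TensorProduct.smul_tmul, Finsupp.smul_single]
        exact ha (c • m)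

/-- The contracting homotopy on a normal word, moving its last letter into the chain. -/
def homotopyWord (i : ℕ) (u : List (Fin n)) :
    (Chain W (i + 1) →₀ M) →ₗ[k] ResTerm k W M (i + 2) :=
  match u.getLast? with
  | none => 0
  | some a => Finsupp.lsum k fun w =>
    if h : (a, w.letter 0) ∈ W then
      (TensorProduct.mk k (Alg k W) (Chain W (i + 2) →₀ M) (word k W u.dropLast)).comp
        (Finsupp.lsingle (Chain.cons a w h))
    else 0

variable (k W M) in
/-- The contracting homotopy in positive degrees. -/
def homotopy (i : ℕ) : ResTerm k W M (i + 1) →ₗ[k] ResTerm k W M (i + 2) :=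
  TensorProduct.lift ((normalBasis k W).constr k fun u => homotopyWord i u.1)

lemma homotopy_word_tmul (i : ℕ) (u : List (Fin n)) (hu : IsNormal W u)
    (v : Chain W (i + 1) →₀ M) :
    homotopy k W M i (word k W u ⊗ₜ v) = homotopyWord i u v := by
  have := (normalBasis k W).constr_basis k (fun u : NormalList W =>
    (homotopyWord i u.1 : (Chain W (i + 1) →₀ M) →ₗ[k] ResTerm k W M (i + 2))) ⟨u, hu⟩
  rw [normalBasis_apply] at this
  rw [homotopy, TensorProduct.lift.tmul, this]

lemma homotopy_one_tmul (i : ℕ) (v : Chain W (i + 1) →₀ M) :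
    homotopy k W M i (1 ⊗ₜ v) = 0 := by
  rw [← word_nil, homotopy_word_tmul _ _ List.isChain_nil]
  rfl

lemma homotopy_concat_tmul (i : ℕ) (u : List (Fin n)) (a : Fin n) (hu : IsNormal W (u ++ [a]))
    (w : Chain W (i + 1)) (m : M) (h : (a, w.letter 0) ∈ W) :
    homotopy k W M i (word k W (u ++ [a]) ⊗ₜ Finsupp.single w m) =
      word k W u ⊗ₜ Finsupp.single (Chain.cons a w h) m := by
  rw [homotopy_word_tmul _ _ hu, homotopyWord]
  simp [h]

lemma homotopy_concat_tmul_of_not (i : ℕ) (u : List (Fin n)) (a : Fin n)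
    (hu : IsNormal W (u ++ [a])) (w : Chain W (i + 1)) (m : M) (h : (a, w.letter 0) ∉ W) :
    homotopy k W M i (word k W (u ++ [a]) ⊗ₜ Finsupp.single w m) = 0 := by
  rw [homotopy_word_tmul _ _ hu, homotopyWord]
  simp [h]

variable [Module (Alg k W) M] [IsScalarTower k (Alg k W) M]

variable (k W M) in
/-- The augmentation of the resolution. -/
def resAug : ResTerm k W M 0 →ₗ[Alg k W] M :=
  extendScalars (Finsupp.lsum k fun _ => LinearMap.id)

lemma resAug_tmul (a : Alg k W) (w : Chain W 0) (m : M) :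
    resAug k W M (a ⊗ₜ Finsupp.single w m) = a • m := by
  simp [resAug]

variable (k W M) in
/-- The differentials of the resolution. -/
def resD (i : ℕ) : ResTerm k W M (i + 1) →ₗ[Alg k W] ResTerm k W M i :=
  extendScalars (Finsupp.lsum k fun w : Chain W (i + 1) =>
    (TensorProduct.mk k (Alg k W) (Chain W i →₀ M) (gen k W (w.letter 0))).comp
      (Finsupp.lsingle w.tail) +
    (-1 : k) ^ (i + 1) • (TensorProduct.mk k (Alg k W) (Chain W i →₀ M) 1).comp
      ((Finsupp.lsingle w.init).comp (Algebra.lsmul k k M (gen k W (w.letter (Fin.last i))))))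

lemma resD_tmul (i : ℕ) (a : Alg k W) (w : Chain W (i + 1)) (m : M) :
    resD k W M i (a ⊗ₜ Finsupp.single w m) =
      (a * gen k W (w.letter 0)) ⊗ₜ Finsupp.single w.tail m +
      (-1 : k) ^ (i + 1) • (a ⊗ₜ Finsupp.single w.init (gen k W (w.letter (Fin.last i)) • m)) := by
  simp [resD, TensorProduct.smul_tmul']

lemma resAug_resD (x : ResTerm k W M 1) : resAug k W M (resD k W M 0 x) = 0 := by
  induction x using resTerm_induction with
  | add x y hx hy => simp only [map_add, hx, hy, add_zero]
  | zero => simp only [map_zero]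
  | word u _ w m =>
    rw [resD_tmul, map_add, LinearMap.map_smul_of_tower, resAug_tmul, resAug_tmul]
    simp [mul_smul]

/-- Removing two letters at the same end produces a product in `W`, which is zero; removing one at
each end occurs twice with opposite signs. -/
lemma resD_resD (i : ℕ) (x : ResTerm k W M (i + 2)) :
    resD k W M i (resD k W M (i + 1) x) = 0 := by
  induction x using resTerm_induction with
  | add x y hx hy => simp only [map_add, hx, hy, add_zero]
  | zero => simp only [map_zero]
  | word u _ w m =>
    rw [resD_tmul, map_add, LinearMap.map_smul_of_tower, resD_tmul, resD_tmul]
    have h1 : word k W u * gen k W (w.letter 0) * gen k W (w.tail.letter 0) = 0 := by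
      rw [mul_assoc, gen_mul_gen k w.mem_zero, mul_zero]
    have h2 : gen k W (w.init.letter (Fin.last i)) • gen k W (w.letter (Fin.last (i + 1))) • m = 0 := by
      rw [← mul_smul, gen_mul_gen k w.mem_last, zero_smul]
    rw [h1, h2, Chain.tail_init]
    simp only [TensorProduct.zero_tmul, zero_add, Finsupp.single_zero, TensorProduct.tmul_zero,
      smul_zero, add_zero]
    change _ • (_ ⊗ₜ[k] Finsupp.single w.tail.init (gen k W (w.letter (Fin.last (i + 1))) • m)) +
      _ • ((word k W u * gen k W (w.letter 0)) ⊗ₜ[k] _) = 0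
    rw [← add_smul, pow_succ (-1 : k) (i + 1)]
    simp

lemma isNormal_concat (u : List (Fin n)) (a b : Fin n) (hu : IsNormal W (u ++ [a]))
    (h : (a, b) ∉ W) : IsNormal W (u ++ [a] ++ [b]) :=
  List.IsChain.append hu (List.isChain_singleton b) (by simpa using h)

lemma word_mul_gen (u : List (Fin n)) (a : Fin n) :
    word k W u * gen k W a = word k W (u ++ [a]) := by
  rw [word_append, word_singleton]

lemma add_neg_smul_add_smul {N : Type*} [AddCommGroup N] [Module k N] (x y : N) (c : k) :
    x + (-c) • y + (0 + c • y) = x := by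
  rw [neg_smul]; abel

lemma sub_eq_add_neg_one_smul_add {N : Type*} [AddCommGroup N] [Module k N] (x y z : N) :
    x - z = x + (-1 : k) ^ (0 + 1) • y + (y - z) := by
  rw [zero_add, pow_one, neg_one_smul]; abel

/-- Let `a` be the last letter of the normal word. If `a` extends the chain, the first term of `resD
x` dies and the two surviving tail terms cancel. Otherwise appending the first chain letter keeps
the word normal, and the homotopy moves it back. The chain has at least two letters, so deleting its
last letter preserves the first. -/
lemma homotopy_identity (i : ℕ) (x : ResTerm k W M (i + 2)) :
    resD k W M (i + 2) (homotopy k W M (i + 1) x) + homotopy k W M i (resD k W M (i + 1) x) =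
      x := by
  induction x using resTerm_induction with
  | zero => simp only [map_zero, add_zero]
  | add x y hx hy =>
    conv_rhs => rw [← hx, ← hy]
    simp only [map_add]
    abel
  | word u hu w m =>
    have hw := w.mem_zero
    rw [resD_tmul, map_add, map_smul]
    rcases List.eq_nil_or_concat u with rfl | ⟨u, a, rfl⟩
    · rw [word_nil, homotopy_one_tmul, homotopy_one_tmul, one_mul, ← word_singleton,
        ← List.nil_append [w.letter 0], homotopy_concat_tmul _ _ _ (List.isChain_singleton _) _ _ hw,
        Chain.cons_tail]
      simp
    · rw [List.concat_eq_append] at hu ⊢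
      by_cases h : (a, w.letter 0) ∈ W
      · have h0 : word k W (u ++ [a]) * gen k W (w.letter 0) = 0 := by
          rw [← word_mul_gen, mul_assoc, gen_mul_gen k h, mul_zero]
        have h' : (a, w.init.letter 0) ∈ W := h
        rw [homotopy_concat_tmul _ _ _ hu _ _ h, resD_tmul, h0,
          homotopy_concat_tmul _ _ _ hu _ _ h', Chain.tail_cons, Chain.init_cons,
          Chain.cons_zero, Chain.cons_last, word_mul_gen, pow_succ (-1 : k) (i + 2),
          TensorProduct.zero_tmul, map_zero, mul_neg_one]
        exact add_neg_smul_add_smul (k := k) (N := ResTerm k W M (i + 2)) _ _ _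
      · have h' : (a, w.init.letter 0) ∉ W := h
        rw [homotopy_concat_tmul_of_not _ _ _ hu _ _ h,
          homotopy_concat_tmul_of_not _ _ _ hu _ _ h', word_mul_gen,
          homotopy_concat_tmul _ _ _ (isNormal_concat u a _ hu h) _ _ hw, Chain.cons_tail,
          map_zero, smul_zero, add_zero, zero_add]

variable (k W M) in
/-- The contracting homotopy in degree zero, on a word. -/
def homotopyZeroWord : List (Fin n) → M →ₗ[k] ResTerm k W M 1
  | [] => 0
  | x :: u => (TensorProduct.mk k (Alg k W) (Chain W 1 →₀ M) 1).comp
      ((Finsupp.lsingle (Chain.single x)).comp (Algebra.lsmul k k M (word k W u))) +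
      (Algebra.lsmul k k (ResTerm k W M 1) (gen k W x)).comp (homotopyZeroWord u)

/-- The map sums over all ways to mark one letter, letting the letters after it act on `m`; marking
the last letter is the first summand here. -/
lemma homotopyZeroWord_concat (u : List (Fin n)) (x : Fin n) (m : M) :
    homotopyZeroWord k W M (u ++ [x]) m =
      word k W u ⊗ₜ Finsupp.single (Chain.single x) m +
        homotopyZeroWord k W M u (gen k W x • m) := by
  induction u generalizing m with
  | nil => simp [homotopyZeroWord]
  | cons y u ih =>
    simp only [List.cons_append, homotopyZeroWord, LinearMap.add_apply, LinearMap.comp_apply,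
      ih, Algebra.lsmul_coe, smul_add, word_append, word_cons, word_nil, mul_one, mul_smul,
      TensorProduct.smul_tmul', smul_eq_mul]
    abel

variable (k W M) in
/-- The contracting homotopy in degree zero. -/
def homotopyZero : ResTerm k W M 0 →ₗ[k] ResTerm k W M 1 :=
  TensorProduct.lift ((normalBasis k W).constr k fun u =>
    (homotopyZeroWord k W M u.1).comp (Finsupp.lsum k fun _ => LinearMap.id))

lemma homotopyZero_word_tmul (u : List (Fin n)) (hu : IsNormal W u) (w : Chain W 0) (m : M) :
    homotopyZero k W M (word k W u ⊗ₜ Finsupp.single w m) = homotopyZeroWord k W M u m := by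
  have := (normalBasis k W).constr_basis k (fun u => (homotopyZeroWord k W M u.1).comp
    (Finsupp.lsum k fun _ : Chain W 0 => LinearMap.id)) ⟨u, hu⟩
  rw [normalBasis_apply] at this
  rw [homotopyZero, TensorProduct.lift.tmul, this]
  simp

/-- A one-letter chain has no first letter left after `Chain.init`, so the one-letter homotopy is
replaced in degree zero by the sum over all marked letters. -/
lemma homotopyZero_identity (x : ResTerm k W M 1) :
    resD k W M 1 (homotopy k W M 0 x) + homotopyZero k W M (resD k W M 0 x) = x := by
  induction x using resTerm_induction with
  | zero => simp only [map_zero, add_zero]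
  | add x y hx hy =>
    conv_rhs => rw [← hx, ← hy]
    simp only [map_add]
    abel
  | word u hu w m =>
    have hlast : w.letter (Fin.last 0) = w.letter 0 := rfl
    rw [resD_tmul, map_add, map_smul, homotopyZero_word_tmul _ hu, hlast]
    rcases List.eq_nil_or_concat u with rfl | ⟨u, a, rfl⟩
    · rw [word_mul_gen, homotopyZero_word_tmul _
          (show IsNormal W ([] ++ [w.letter 0]) from List.isChain_singleton _),
        homotopyZeroWord_concat, Chain.single_apply_zero, word_nil, homotopy_one_tmul]
      simp [homotopyZeroWord]
    · rw [List.concat_eq_append] at hu ⊢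
      by_cases h : (a, w.letter 0) ∈ W
      · have h0 : word k W (u ++ [a]) * gen k W (w.letter 0) = 0 := by
          rw [← word_mul_gen, mul_assoc, gen_mul_gen k h, mul_zero]
        rw [homotopy_concat_tmul _ _ _ hu _ _ h, resD_tmul, h0, Chain.tail_cons,
          Chain.init_cons_one, homotopyZeroWord_concat, ← mul_smul, gen_mul_gen k h,
          Chain.cons_zero, Chain.cons_last, word_mul_gen, TensorProduct.zero_tmul, map_zero,
          zero_smul, map_zero, add_zero, hlast, pow_succ (-1 : k) (0 + 1), mul_neg_one]
        exact add_neg_smul_add_smul (k := k) (N := ResTerm k W M 1) _ _ _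
      · rw [homotopy_concat_tmul_of_not _ _ _ hu _ _ h, word_mul_gen,
          homotopyZero_word_tmul _ (isNormal_concat u a _ hu h),
          homotopyZeroWord_concat _ (w.letter 0), Chain.single_apply_zero, map_zero, zero_add]
        have := add_neg_smul_add_smul (word k W (u ++ [a]) ⊗ₜ[k] Finsupp.single w m)
          (homotopyZeroWord k W M (u ++ [a]) (gen k W (w.letter 0) • m)) (-1 : k)
        rw [neg_neg, one_smul, zero_add] at this
        rw [zero_add, pow_one]
        exact this

/-- Modulo boundaries the last letter of a word slides across the tensor sign to act on `m`;
repeating this empties the word. -/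
lemma sub_resAug_mem_range (x : ResTerm k W M 0) :
    x - 1 ⊗ₜ Finsupp.single default (resAug k W M x) ∈ LinearMap.range (resD k W M 0) := by
  induction x using resTerm_induction with
  | zero => simp only [map_zero, Finsupp.single_zero, TensorProduct.tmul_zero, sub_self, zero_mem]
  | add x y hx hy =>
    have := add_mem hx hy
    rw [map_add, Finsupp.single_add, TensorProduct.tmul_add]
    convert this using 1
    abel
  | word u hu w m =>
    clear hu
    obtain rfl := Unique.eq_default w
    rw [resAug_tmul]
    induction u using List.reverseRecOn generalizing m with
    | nil => simp
    | append_singleton u x ih =>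
      have h1 : (resD k W M 0) (word k W u ⊗ₜ Finsupp.single (Chain.single x) m) ∈
        LinearMap.range (resD k W M 0) := ⟨_, rfl⟩
      have h2 := add_mem h1 (ih (gen k W x • m))
      have e1 : (Chain.single x : Chain W 1).tail = default := Unique.eq_default _
      have e2 : (Chain.single x : Chain W 1).init = default := Unique.eq_default _
      have e3 : (Chain.single x : Chain W 1).letter 0 = x := rfl
      have e4 : (Chain.single x : Chain W 1).letter (Fin.last 0) = x := rfl
      rw [resD_tmul, e1, e2, e3, e4, word_mul_gen, ← mul_smul, word_mul_gen] at h2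
      convert h2 using 1
      exact sub_eq_add_neg_one_smul_add (k := k) (N := ResTerm k W M 0) _ _ _

lemma resAug_surjective : Function.Surjective (resAug k W M) := fun m =>
  ⟨1 ⊗ₜ Finsupp.single default m, by rw [resAug_tmul, one_smul]⟩

lemma resD_zero_exact : Function.Exact (resD k W M 0) (resAug k W M) := by
  intro x
  constructor
  · intro hx
    have := sub_resAug_mem_range x
    rw [hx, Finsupp.single_zero, TensorProduct.tmul_zero] at this
    exact (sub_zero x) ▸ this
  · rintro ⟨z, rfl⟩
    exact resAug_resD z

lemma resD_exact (i : ℕ) : Function.Exact (resD k W M (i + 1)) (resD k W M i) := by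
  intro x
  constructor
  · intro hx
    cases i with
    | zero =>
      have := homotopyZero_identity x
      rw [hx, map_zero, add_zero] at this
      exact ⟨_, this⟩
    | succ i =>
      have := homotopy_identity i x
      rw [hx, map_zero, add_zero] at this
      exact ⟨_, this⟩
  · rintro ⟨z, rfl⟩
    exact resD_resD i z

end Resolution

/-! ### Gradings defined by a basis. -/

section BasisGrading

variable {k : Type u} [Field k] {V κ : Type*} [AddCommGroup V] [Module k V]
  (c : Module.Basis κ k V) (g : κ → ℤ)

/-- The homogeneous components defined by assigning a degree to each element of a basis. -/
def basisDeg (j : ℤ) : Submodule k V := Submodule.span k (c '' {a | g a = j})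

lemma mem_basisDeg_iff (j : ℤ) (x : V) :
    x ∈ basisDeg c g j ↔ ∀ a, c.repr x a ≠ 0 → g a = j := by
  rw [basisDeg, Module.Basis.mem_span_image]
  constructor
  · intro h a ha
    exact h (Finsupp.mem_support_iff.2 ha)
  · intro h a ha
    exact h a (Finsupp.mem_support_iff.1 ha)

lemma basis_mem_basisDeg (a : κ) : c a ∈ basisDeg c g (g a) :=
  Submodule.subset_span ⟨a, rfl, rfl⟩

lemma isInternal_basisDeg :
    DirectSum.IsInternal fun j => (basisDeg c g j).toAddSubgroup := by
  -- The sum of the components determines each one: component `j` keeps exactly the coordinates of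
  -- degree `j`.
  have key : ∀ (x : DirectSum ℤ fun j => (basisDeg c g j).toAddSubgroup) (j : ℤ) (a : κ),
      c.repr (x j : V) a = if g a = j then
        c.repr (DirectSum.coeAddMonoidHom (fun j => (basisDeg c g j).toAddSubgroup) x) a
        else 0 := by
    intro x j a
    induction x using DirectSum.induction_on with
    | zero => simp
    | add x y hx hy => simp only [DirectSum.add_apply, map_add, AddSubgroup.coe_add,
        Finsupp.add_apply, hx, hy]; split_ifs <;> simp
    | of i s =>
      rw [DirectSum.coeAddMonoidHom_of]
      have hs := (mem_basisDeg_iff c g i s.1).1 s.2 a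
      by_cases hij : i = j
      · subst hij
        rw [DirectSum.of_eq_same]
        split_ifs with h
        · rfl
        · by_contra h0
          exact h (hs h0)
      · rw [DirectSum.of_eq_of_ne _ _ _ (Ne.symm hij)]
        split_ifs with h
        · by_contra h0
          exact hij ((hs (fun h' => h0 (by rw [h']; simp))).symm.trans h)
        · simp
  constructor
  · rw [injective_iff_map_eq_zero]
    intro x hx
    refine DFinsupp.ext fun j => Subtype.ext (c.ext_elem fun a => ?_)
    have := key x j a
    rw [hx] at this
    rw [this]
    simp
  · intro v
    change v ∈ AddMonoidHom.range _
    rw [← c.linearCombination_repr v, Finsupp.linearCombination_apply]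
    refine AddSubgroup.sum_mem _ fun a _ => ⟨DirectSum.of
      (fun j => (basisDeg c g j).toAddSubgroup) (g a)
      ⟨c.repr v a • c a, Submodule.smul_mem _ _ (basis_mem_basisDeg c g a)⟩, ?_⟩
    rw [DirectSum.coeAddMonoidHom_of]

end BasisGrading

/-! ### Graded free modules and homogeneous bases. -/

section FreeModule

open TensorProduct

variable {k A : Type u} [Field k] [Ring A] [Algebra k A] (𝒜 : ℕ → Submodule k A)
  {κ : Type*} (c : Module.Basis κ k A) (ℓ : κ → ℕ)
  (hc : ∀ i, 𝒜 i = Submodule.span k (c '' {u | ℓ u = i}))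
  {V ι : Type u} [AddCommGroup V] [Module k V] (b : Module.Basis ι k V) (δ : ι → ℤ)

/-- The degrees of the elements of the `k`-basis of `A ⊗ V` given by homogeneous bases. -/
def tensorDeg (p : κ × ι) : ℤ := ℓ p.1 + δ p.2

include hc in
lemma tmul_mem_basisDeg {i : ℕ} {j : ℤ} {x : A} {v : V} (hx : x ∈ 𝒜 i)
    (hv : v ∈ basisDeg b δ j) :
    x ⊗ₜ[k] v ∈ basisDeg (c.tensorProduct b) (tensorDeg ℓ δ) (i + j) := by
  rw [hc] at hx
  induction hv using Submodule.span_induction with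
  | mem v hv =>
    obtain ⟨t, rfl, rfl⟩ := hv
    induction hx using Submodule.span_induction with
    | mem x hx =>
      obtain ⟨u, rfl, rfl⟩ := hx
      have := basis_mem_basisDeg (c.tensorProduct b) (tensorDeg ℓ δ) (u, t)
      rwa [Module.Basis.tensorProduct_apply] at this
    | zero => rw [TensorProduct.zero_tmul]; exact zero_mem _
    | add x y _ _ hx hy => rw [TensorProduct.add_tmul]; exact add_mem hx hy
    | smul r x _ hx => rw [← TensorProduct.smul_tmul']; exact Submodule.smul_mem _ _ hx
  | zero => rw [TensorProduct.tmul_zero]; exact zero_mem _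
  | add x y _ _ hx hy => rw [TensorProduct.tmul_add]; exact add_mem hx hy
  | smul r x _ hx => rw [TensorProduct.tmul_smul]; exact Submodule.smul_mem _ _ hx

include hc in
lemma basis_mem_component (u : κ) : c u ∈ 𝒜 (ℓ u) := by
  rw [hc]
  exact Submodule.subset_span ⟨u, rfl, rfl⟩

variable [SetLike.GradedMonoid 𝒜]

/-- The graded free module `A ⊗ V`, where `V` has a basis with given degrees. -/
def freeGrMod : GrMod 𝒜 where
  carrier := A ⊗[k] V
  deg j := (basisDeg (c.tensorProduct b) (tensorDeg ℓ δ) j).toAddSubgroup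
  isInternal := isInternal_basisDeg _ _
  smul_mem i j a m ha hm := by
    rw [Submodule.mem_toAddSubgroup] at hm ⊢
    induction hm using Submodule.span_induction with
    | mem m hm =>
      obtain ⟨⟨u, t⟩, rfl, rfl⟩ := hm
      rw [Module.Basis.tensorProduct_apply, TensorProduct.smul_tmul', smul_eq_mul]
      have := tmul_mem_basisDeg 𝒜 c ℓ hc b δ
        (SetLike.mul_mem_graded ha (basis_mem_component 𝒜 c ℓ hc u)) (basis_mem_basisDeg b δ t)
      convert this using 1
      simp [tensorDeg, add_assoc]
    | zero => rw [smul_zero]; exact zero_mem _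
    | add x y _ _ hx hy => rw [smul_add]; exact add_mem hx hy
    | smul r x _ hx => rw [smul_comm]; exact Submodule.smul_mem _ _ hx

lemma isFree_freeGrMod : (freeGrMod 𝒜 c ℓ hc b δ).IsFree := by
  refine ⟨ι, Algebra.TensorProduct.basis A b, δ, fun i => ?_⟩
  have := tmul_mem_basisDeg 𝒜 c ℓ hc b δ (SetLike.GradedOne.one_mem (A := 𝒜))
    (basis_mem_basisDeg b δ i)
  rw [Nat.cast_zero, zero_add, ← Algebra.TensorProduct.basis_apply] at this
  exact this

variable {𝒜 c ℓ hc b δ}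

lemma tmul_mem_deg {i : ℕ} {j : ℤ} {x : A} {v : V} (hx : x ∈ 𝒜 i) (hv : v ∈ basisDeg b δ j) :
    x ⊗ₜ[k] v ∈ (freeGrMod 𝒜 c ℓ hc b δ).deg (i + j) :=
  tmul_mem_basisDeg 𝒜 c ℓ hc b δ hx hv

lemma smul_mem_freeGrMod (r : k) {j : ℤ} {x : A ⊗[k] V}
    (hx : x ∈ (freeGrMod 𝒜 c ℓ hc b δ).deg j) :
    (r • x : A ⊗[k] V) ∈ (freeGrMod 𝒜 c ℓ hc b δ).deg j :=
  Submodule.smul_mem (basisDeg (c.tensorProduct b) (tensorDeg ℓ δ) j) r hx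

lemma algebraMap_smul_mem (N : GrMod 𝒜) (r : k) {j : ℤ} {x : N.carrier}
    (hx : x ∈ N.deg j) : algebraMap k A r • x ∈ N.deg j := by
  have h : algebraMap k A r ∈ 𝒜 0 := by
    rw [Algebra.algebraMap_eq_smul_one]
    exact Submodule.smul_mem _ _ (SetLike.GradedOne.one_mem (A := 𝒜))
  simpa using N.smul_mem 0 j _ x h hx

lemma isHomogeneousMap_of_basis (N : GrMod 𝒜)
    (f : A ⊗[k] V →ₗ[A] N.carrier)
    (hf : ∀ t, f ((1 : A) ⊗ₜ[k] b t) ∈ N.deg (δ t)) :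
    GrMod.IsHomogeneousMap (M := freeGrMod 𝒜 c ℓ hc b δ) f := by
  intro j
  suffices h : ∀ m : A ⊗[k] V, m ∈ basisDeg (c.tensorProduct b) (tensorDeg ℓ δ) j →
      f m ∈ N.deg j from h
  intro m hm
  induction hm using Submodule.span_induction with
  | mem m hm =>
    obtain ⟨⟨u, t⟩, rfl, rfl⟩ := hm
    have h1 : c.tensorProduct b (u, t) = c u • ((1 : A) ⊗ₜ[k] b t) := by
      rw [Module.Basis.tensorProduct_apply, TensorProduct.smul_tmul', smul_eq_mul, mul_one]
    rw [h1]
    have h2 := N.smul_mem _ _ _ _ (basis_mem_component 𝒜 c ℓ hc u) (hf t)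
    rw [← map_smul] at h2
    exact h2
  | zero => rw [map_zero]; exact zero_mem _
  | add x y _ _ hx hy => rw [map_add]; exact add_mem hx hy
  | smul r x _ hx =>
    have h := algebraMap_smul_mem N r hx
    rw [← map_smul] at h
    rw [← algebraMap_smul A r x]
    exact h

/-- A graded module viewed as a vector space. -/
abbrev GrMod.toModule (N : GrMod 𝒜) : Module k N.carrier :=
  Module.compHom N.carrier (algebraMap k A)

/-- Scalars have degree zero, so the components are `k`-subspaces and their bases can be collected.
-/
lemma exists_homogeneous_basis (N : GrMod 𝒜) :
    letI := N.toModule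
    ∃ (ι : Type u) (b : Module.Basis ι k N.carrier) (δ : ι → ℤ),
      ∀ j x, x ∈ N.deg j ↔ x ∈ basisDeg b δ j := by
  let _ := N.toModule
  let D : ℤ → Submodule k N.carrier := fun j =>
    { N.deg j with smul_mem' := fun r x hx => algebraMap_smul_mem N r hx }
  have hD : DirectSum.IsInternal D := N.isInternal
  let v := fun j => Module.Basis.ofVectorSpace k (D j)
  refine ⟨_, hD.collectedBasis v, Sigma.fst, fun j x => ?_⟩
  rw [mem_basisDeg_iff]
  constructor
  · rintro hx ⟨i, a⟩ hne
    by_contra hij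
    exact hne (hD.collectedBasis_repr_of_mem_ne v (Ne.symm hij) hx)
  · intro h
    change x ∈ D j
    rw [← (hD.collectedBasis v).linearCombination_repr x, Finsupp.linearCombination_apply]
    refine Submodule.sum_mem _ fun a ha => Submodule.smul_mem _ _ ?_
    have := hD.collectedBasis_mem v a
    rw [h a (Finsupp.mem_support_iff.1 ha)] at this
    exact this

end FreeModule

/-! ### The resolution with its grading. -/

section GradedResolution

open TensorProduct

variable {k : Type u} [Field k] {n : ℕ} {W : Finset (Fin n × Fin n)}

instance : SetLike.GradedMonoid (component k W) where
  one_mem := word_mem_component k W []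
  mul_mem i j a b ha hb := by
    have := Submodule.mul_mem_mul ha hb
    rw [component, component, Submodule.span_mul_span] at this
    refine Submodule.span_mono ?_ this
    rintro _ ⟨_, ⟨l, rfl, rfl⟩, _, ⟨l', rfl, rfl⟩, rfl⟩
    exact ⟨l ++ l', by simp, by simp⟩

lemma component_eq_span (i : ℕ) : component k W i =
    Submodule.span k (normalBasis k W '' {u | u.1.length = i}) := by
  apply le_antisymm
  · rw [component, Submodule.span_le]
    rintro _ ⟨l, hl, rfl⟩
    change word k W l ∈ _
    by_cases h : IsNormal W l
    · exact Submodule.subset_span ⟨⟨l, h⟩, hl, by simp⟩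
    · rw [word_eq_zero k h]
      exact zero_mem _
  · rw [Submodule.span_le]
    rintro _ ⟨u, rfl, rfl⟩
    rw [normalBasis_apply]
    exact word_mem_component k W u.1

lemma gen_mem_component (x : Fin n) : gen k W x ∈ component k W 1 := by
  simpa using word_mem_component k W [x]

/-- Freeness over the algebra needs only a `k`-basis of `N`; choosing it homogeneous makes the terms
graded free. -/
theorem hasFreeResolution_of_chain_isEmpty (N : GrMod (component k W)) (d : ℕ)
    (hd : ∀ i, d < i → IsEmpty (Chain W i)) : N.HasFreeResolutionOfLengthLE d := by
  let _ := N.toModule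
  have : IsScalarTower k (Alg k W) N.carrier :=
    ⟨fun r a x => by
      rw [Algebra.smul_def, mul_smul]; rfl⟩
  obtain ⟨ι, b, δ, hb⟩ := exists_homogeneous_basis N
  let B : ∀ i, Module.Basis (Σ _ : Chain W i, ι) k (Chain W i →₀ N.carrier) := fun i =>
    Finsupp.basis fun _ => b
  -- Each chain letter counts as one degree, which makes the differentials homogeneous of degree
  -- zero.
  let Δ : ∀ i, (Σ _ : Chain W i, ι) → ℤ := fun i p => i + δ p.2
  have hB : ∀ (i : ℕ) (w : Chain W i) (j : ℤ) (x : N.carrier), x ∈ N.deg j →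
      Finsupp.single w x ∈ basisDeg (B i) (Δ i) (i + j) := by
    intro i w j x hx
    rw [hb] at hx
    induction hx using Submodule.span_induction with
    | mem x hx =>
      obtain ⟨t, rfl, rfl⟩ := hx
      have := basis_mem_basisDeg (B i) (Δ i) ⟨w, t⟩
      simpa [B, Δ] using this
    | zero => rw [Finsupp.single_zero]; exact zero_mem _
    | add x y _ _ hx hy => rw [Finsupp.single_add]; exact add_mem hx hy
    | smul r x _ hx => rw [← Finsupp.smul_single]; exact Submodule.smul_mem _ _ hx
  have hbN : ∀ t, b t ∈ N.deg (δ t) := fun t => (hb _ _).2 (basis_mem_basisDeg b δ t)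
  refine ⟨fun i => freeGrMod (component k W) (normalBasis k W)
    (fun u => u.1.length) component_eq_span (B i) (Δ i), resAug k W N.carrier, resD k W N.carrier,
    fun i => isFree_freeGrMod _ _ _ _ _ _, ?_, fun i => ?_, resAug_surjective, resD_zero_exact,
    resD_exact, fun i hi => ?_⟩
  · refine isHomogeneousMap_of_basis N _ ?_
    rintro ⟨w, t⟩
    have : B 0 ⟨w, t⟩ = Finsupp.single w (b t) := by simp [B]
    rw [this]
    erw [resAug_tmul]
    simpa [Δ] using hbN t
  · refine isHomogeneousMap_of_basis _ _ ?_
    rintro ⟨w, t⟩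
    have : B (i + 1) ⟨w, t⟩ = Finsupp.single w (b t) := by simp [B]
    rw [this]
    erw [resD_tmul]
    refine add_mem ?_ ?_
    · rw [one_mul]
      have := tmul_mem_deg (c := normalBasis k W) (ℓ := fun u => u.1.length)
        (hc := component_eq_span) (gen_mem_component (W := W) (w.letter 0))
        (hB i w.tail _ _ (hbN t))
      have e : ((1 : ℕ) : ℤ) + (i + δ t) = Δ (i + 1) ⟨w, t⟩ := by simp only [Δ]; push_cast; ring
      rw [e] at this
      exact this
    · have h1 : gen k W (w.letter (Fin.last i)) • b t ∈ N.deg (1 + δ t) := by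
        have := N.smul_mem 1 _ _ _ (gen_mem_component (W := W) (w.letter (Fin.last i))) (hbN t)
        simpa using this
      have := tmul_mem_deg (c := normalBasis k W) (ℓ := fun u => u.1.length)
        (hc := component_eq_span) (word_mem_component k W []) (hB i w.init _ _ h1)
      have h2 := smul_mem_freeGrMod ((-1 : k) ^ (i + 1)) this
      have e : (([] : List (Fin n)).length : ℤ) + (i + (1 + δ t)) = Δ (i + 1) ⟨w, t⟩ := by
        simp only [Δ, List.length_nil]; push_cast; ring
      rw [e] at h2
      exact h2
  · have := hd i hi
    change Subsingleton (Alg k W ⊗[k] (Chain W i →₀ N.carrier))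
    infer_instance

end GradedResolution

/-! ### The trivial module as a test for global dimension. -/

section TrivialModule

variable (k : Type u) [Field k] {n : ℕ} (W : Finset (Fin n × Fin n))

/-- The trivial module structure on the ground field. -/
abbrev trivialModule : Module (Alg k W) k :=
  Module.compHom k (augmentation k W).toRingHom

lemma augmentation_word_of_ne_nil {l : List (Fin n)} (h : l ≠ []) :
    augmentation k W (word k W l) = 0 := by
  obtain ⟨x, l, rfl⟩ := List.exists_cons_of_ne_nil h
  simp

lemma augmentation_of_mem_component {i : ℕ} {a : Alg k W} (ha : a ∈ component k W i)
    (hi : i ≠ 0) : augmentation k W a = 0 := by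
  induction ha using Submodule.span_induction with
  | mem a ha =>
    obtain ⟨l, rfl, rfl⟩ := ha
    exact augmentation_word_of_ne_nil k W (by rintro rfl; exact hi rfl)
  | zero => simp
  | add a b _ _ ha hb => simp [ha, hb]
  | smul c a _ ha => simp [ha]

/-- The trivial graded module, concentrated in degree zero. -/
def trivialGrMod : GrMod (component k W) :=
  letI := trivialModule k W
  { carrier := k
    deg := fun j =>
      (basisDeg (Module.Basis.singleton Unit k) (fun _ => (0 : ℤ)) j).toAddSubgroup
    isInternal := isInternal_basisDeg _ _
    smul_mem := fun i j a m ha hm => by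
      change augmentation k W a • m ∈ basisDeg _ _ _
      by_cases hi : i = 0
      · subst hi
        rw [Nat.cast_zero, zero_add]
        exact Submodule.smul_mem _ _ hm
      · rw [augmentation_of_mem_component k W ha hi, zero_smul]
        exact zero_mem _ }

lemma repr_nil_eq_augmentation (a : Alg k W) :
    (normalBasis k W).repr a ⟨[], List.isChain_nil⟩ = augmentation k W a := by
  have ha : a ∈ Submodule.span k (Set.range (word k W)) := by rw [span_word]; trivial
  induction ha using Submodule.span_induction with
  | mem a ha =>
    obtain ⟨l, rfl⟩ := ha
    by_cases h : l = []
    · subst h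
      have := normalBasis_repr_word k W ⟨[], List.isChain_nil⟩
      rw [this]
      simp
    · rw [augmentation_word_of_ne_nil k W h, repr_eq_zero_of_mem_wordSpan (m := 1)
        (Submodule.subset_span ⟨l, List.length_pos_iff.2 h, rfl⟩) _ (by simp)]
  | zero => simp
  | add a b _ _ ha hb => simp [ha, hb]
  | smul c a _ ha => simp [ha]

lemma mem_wordSpan_of_augmentation_eq_zero (a : Alg k W) (h : augmentation k W a = 0) :
    a ∈ wordSpan k W 1 := by
  refine mem_wordSpan_of_repr fun u hu => ?_
  obtain ⟨l, hl⟩ := u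
  obtain rfl : l = [] := by simpa using hu
  rw [repr_nil_eq_augmentation, h]

open CategoryTheory in
lemma HasFreeResolution.hasProjectiveDimensionLT {A : Type u} [Ring A] [Algebra k A]
    {𝒜 : ℕ → Submodule k A} {N : GrMod 𝒜} {d : ℕ} (h : N.HasFreeResolutionOfLengthLE d) :
    HasProjectiveDimensionLT (ModuleCat.of A N.carrier) (d + 1) := by
  obtain ⟨F, ε, f, hF, -, -, hε, h0, hex, hd⟩ := h
  refine hasProjectiveDimensionLT_of_resolution d (ModuleCat.of A N.carrier)
    (fun i => ModuleCat.of A (F i).carrier) ε f (fun i => ?_) hε h0 hex hd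
  obtain ⟨ι, b, -⟩ := hF i
  exact Module.Projective.of_basis b

variable {k W}

open CategoryTheory in
-- The syzygy of the trivial module retracts onto the left ideal of `w 0`, which starts the descent
-- along the walk. For `d = 0` the mere existence of a letter is contradictory.
theorem not_walk_of_hasFreeResolution {d : ℕ}
    (h : ∀ N : GrMod (component k W), N.HasFreeResolutionOfLengthLE d) (w : ℕ → Fin n) :
    ¬ ∀ i, i + 1 ≤ d → (w (i + 1), w i) ∈ W := by
  intro hw
  let _ := trivialModule k W
  have hpd : HasProjectiveDimensionLT (ModuleCat.of (Alg k W) k) (d + 1) :=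
    HasFreeResolution.hasProjectiveDimensionLT k (h (trivialGrMod k W))
  let f : Alg k W →ₗ[Alg k W] k :=
    { toFun := augmentation k W
      map_add' := map_add _
      map_smul' := fun a b => map_mul (augmentation k W) a b }
  have hf : Function.Surjective f := fun c =>
    ⟨algebraMap k (Alg k W) c, (augmentation k W).commutes c⟩
  have hker : ∀ a, f a = 0 → a ∈ wordSpan k W 1 :=
    mem_wordSpan_of_augmentation_eq_zero k W
  have hgen : f (gen k W (w 0)) = 0 := augmentation_gen (w 0)
  cases d with
  | zero =>
    refine not_projective_of_gen_mem_ker f hf hker hgen ?_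
    exact (IsProjective.iff_projective (R := Alg k W) _).2
      (projective_iff_hasProjectiveDimensionLT_one.2 hpd)
  | succ e =>
    exact not_walk_of_hasProjectiveDimensionLT e (w 0)
      (hasProjectiveDimensionLT_genIdeal f hf hker hgen e hpd) w rfl
      fun i hi => hw i (by omega)

end TrivialModule

/-! ### Global dimension, growth and the equivalences. -/

section Main

variable {k : Type u} [Field k] {n : ℕ} {W : Finset (Fin n × Fin n)}

lemma hasFiniteGlobalDimension_iff {A : Type u} [Ring A] [Algebra k A] (𝒜 : ℕ → Submodule k A) :
    HasFiniteGlobalDimension 𝒜 ↔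
      ∃ d : ℕ, ∀ N : GrMod 𝒜, N.HasFreeResolutionOfLengthLE d := by
  simp only [HasFiniteGlobalDimension, globalDimension, iInf_lt_iff]
  constructor
  · rintro ⟨d, h, -⟩
    exact ⟨d, h⟩
  · rintro ⟨d, h⟩
    exact ⟨d, h, ENat.natCast_lt_top d⟩

lemma isAcyclic_of_hasFiniteGlobalDimension
    (h : HasFiniteGlobalDimension (component k W)) : IsAcyclic (graph W) := by
  obtain ⟨d, hd⟩ := (hasFiniteGlobalDimension_iff _).1 h
  refine isAcyclic_of_no_walk fun w hw => ?_
  -- The descent follows edges backwards, so the walk is reversed.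
  refine not_walk_of_hasFreeResolution hd (fun i => w (d - i)) fun i hi => ?_
  have := hw (d - (i + 1))
  rwa [show d - (i + 1) + 1 = d - i by omega] at this

lemma isTournament_of_acyclic (h : IsAcyclic (graph W))
    (htot : ∀ x y, x ≠ y → (x, y) ∈ W ∨ (y, x) ∈ W) : IsTournament (graph W) :=
  ⟨h.irrefl, fun x y hxy => (htot x y hxy).elim (fun h' => Or.inl ⟨h', h.asymm h'⟩)
    fun h' => Or.inr ⟨h', h.asymm h'⟩⟩

lemma total_of_hasPolynomialGrowth (h : HasPolynomialGrowth (component k W))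
    (hirr : ∀ x, (x, x) ∉ W) (x y : Fin n) (hxy : x ≠ y) : (x, y) ∈ W ∨ (y, x) ∈ W := by
  by_contra hne
  push Not at hne
  exact hxy (eq_of_hasPolynomialGrowth W k h (hirr x) hne.1 (hirr y) hne.2).1.symm

section Ordered

variable {y : Equiv.Perm (Fin n)}
  (hy : (W : Set (Fin n × Fin n)) = {p | ∃ i j : Fin n, i < j ∧ p = (y j, y i)})

include hy

lemma chain_isEmpty_of_eq (i : ℕ) (hi : n < i) : IsEmpty (Chain W i) := by
  refine ⟨fun w => ?_⟩
  have hinj : Function.Injective w.letter := by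
    -- Chains are strictly decreasing words, so their letters are distinct.
    have hanti : ∀ a b : Fin i, a < b → y.symm (w.letter b) < y.symm (w.letter a) := by
      intro a b hab
      obtain ⟨b, hb⟩ := b
      induction b with
      | zero => exact absurd hab (Nat.not_lt_zero _)
      | succ b ih =>
        have h1 := (mem_iff_of_eq hy _ _).1 (w.mem ⟨b, by omega⟩ ⟨b + 1, hb⟩ rfl)
        rcases Nat.lt_succ_iff_lt_or_eq.1 hab with h | h
        · exact h1.trans (ih (by omega) h)
        · have : a = ⟨b, by omega⟩ := Fin.ext h
          rwa [this]
    intro a b hab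
    rcases lt_trichotomy a b with h | h | h
    · exact absurd (hanti _ _ h) (by rw [hab]; exact lt_irrefl _)
    · exact h
    · exact absurd (hanti _ _ h) (by rw [hab]; exact lt_irrefl _)
  have := Fintype.card_le_of_injective _ hinj
  simp at this
  omega

lemma globalDimension_of_eq : globalDimension (component k W) = (n : ℕ∞) := by
  apply le_antisymm
  · exact iInf₂_le n fun N => hasFreeResolution_of_chain_isEmpty N n (chain_isEmpty_of_eq hy)
  · refine le_iInf₂ fun d hd => ?_
    rw [Nat.cast_le]
    by_contra hlt
    push Not at hlt
    refine not_walk_of_hasFreeResolution hd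
      -- The longest chain, read upwards. The default beyond `n` is never reached, because only
      -- indices up to `d < n` matter.
      (fun i => y (if h : i < n then ⟨i, h⟩ else ⟨0, by omega⟩)) fun i hi => ?_
    rw [mem_iff_of_eq hy]
    have h1 : i < n := by omega
    have h2 : i + 1 < n := by omega
    simp [h1, h2]

lemma normalCount_of_eq (m : ℕ) : normalCount W m = n.multichoose m :=
  normalCount_eq_multichoose (normalWords_eq_of_eq hy) m

lemma hasFiniteGlobalDimension_of_eq : HasFiniteGlobalDimension (component k W) := by
  rw [HasFiniteGlobalDimension, globalDimension_of_eq hy]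
  exact ENat.natCast_lt_top n

lemma hasPolynomialGrowth_of_eq : HasPolynomialGrowth (component k W) := by
  -- A single dimension is at most the cumulative one, `(i + n).choose n`, hence at most `(i + n) ^
  -- n`.
  refine ⟨(Polynomial.X + Polynomial.C (n : ℝ)) ^ n, fun i => ?_⟩
  rw [finrank_component, normalCount_of_eq hy]
  have h1 : n.multichoose i ≤ (i + n).choose n := by
    rw [← Nat.sum_range_multichoose]
    exact Finset.single_le_sum (f := fun i => n.multichoose i) (fun _ _ => Nat.zero_le _)
      (Finset.self_mem_range_succ i)
  have h2 := h1.trans (Nat.choose_le_pow (i + n) n)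
  simp only [Polynomial.eval_pow, Polynomial.eval_add, Polynomial.eval_X, Polynomial.eval_C]
  exact_mod_cast h2

lemma hasPolynomialGrowthOfDegree_of_eq :
    HasPolynomialGrowthOfDegree (component k W) n := by
  have hsum : ∀ m : ℕ, ∑ i ∈ Finset.range (m + 1),
      (Module.finrank k (component k W i) : ℝ) = ((m + n).choose n : ℝ) := by
    intro m
    rw [← Nat.sum_range_multichoose]
    push_cast
    exact Finset.sum_congr rfl fun i _ => by rw [finrank_component, normalCount_of_eq hy]
  unfold HasPolynomialGrowthOfDegree
  simp only [hsum]
  constructor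
  -- For `m ≥ 1` one has `m + n ≤ (n + 1) * m`.
  · refine Asymptotics.IsBigO.of_bound (((n : ℝ) + 1) ^ n) ?_
    filter_upwards [Filter.eventually_ge_atTop 1] with m hm
    rw [Real.norm_of_nonneg (by positivity), Real.norm_of_nonneg (by positivity), ← mul_pow]
    have h1 : ((m + n).choose n : ℝ) ≤ ((m + n : ℕ) : ℝ) ^ n := by
      exact_mod_cast Nat.choose_le_pow (m + n) n
    refine h1.trans (pow_le_pow_left₀ (by positivity) ?_ n)
    have : (1 : ℝ) ≤ m := by exact_mod_cast hm
    push_cast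
    nlinarith [(Nat.cast_nonneg n : (0 : ℝ) ≤ n)]
  · refine Asymptotics.IsBigO.of_bound (n.factorial : ℝ) (Filter.Eventually.of_forall fun m => ?_)
    rw [Real.norm_of_nonneg (by positivity), Real.norm_of_nonneg (by positivity)]
    have h1 := Nat.pow_le_choose (α := ℝ) n (m + n)
    have h2 : m + n + 1 - n = m + 1 := by omega
    rw [h2] at h1
    have h3 : (m : ℝ) ^ n ≤ ((m + 1 : ℕ) : ℝ) ^ n :=
      pow_le_pow_left₀ (by positivity) (by push_cast; linarith) n
    have h4 : (0 : ℝ) < n.factorial := by positivity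
    rw [div_le_iff₀ h4] at h1
    linarith

end Ordered

end Main

end MonomialAlgebra

end

theorem theorem3 (k : Type u) [Field k] (n : ℕ) (W : Finset (Fin n × Fin n)) :
    List.TFAE [
      MonomialAlgebra.HasFiniteGlobalDimension (MonomialAlgebra.component k W) ∧
        MonomialAlgebra.HasPolynomialGrowth (MonomialAlgebra.component k W),
      MonomialAlgebra.HasFiniteGlobalDimension (MonomialAlgebra.component k W) ∧
        W.card = n.choose 2,
      MonomialAlgebra.HasPolynomialGrowth (MonomialAlgebra.component k W) ∧
        W ∩ Finset.diag Finset.univ = ∅ ∧ W.card = n.choose 2,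
      MonomialAlgebra.IsAcyclic (MonomialAlgebra.graph W) ∧
        MonomialAlgebra.IsTournament (MonomialAlgebra.graph W),
      MonomialAlgebra.hilbertSeries (MonomialAlgebra.component k W) =
        ((1 - PowerSeries.X : PowerSeries ℚ) ^ n)⁻¹,
      ∃ y : Equiv.Perm (Fin n), MonomialAlgebra.normalWords W =
        {w | ∃ α : Fin n → ℕ, w = (List.ofFn fun i => FreeMonoid.of (y i) ^ α i).prod},
      ∃ y : Equiv.Perm (Fin n), (W : Set (Fin n × Fin n)) =
        {p | ∃ i j : Fin n, i < j ∧ p = (y j, y i)}] ∧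
    (MonomialAlgebra.HasFiniteGlobalDimension (MonomialAlgebra.component k W) ∧
        MonomialAlgebra.HasPolynomialGrowth (MonomialAlgebra.component k W) →
      MonomialAlgebra.globalDimension (MonomialAlgebra.component k W) = (n : ℕ∞) ∧
        MonomialAlgebra.HasPolynomialGrowthOfDegree (MonomialAlgebra.component k W) n) := by
  open MonomialAlgebra in
  have h14 : HasFiniteGlobalDimension (component k W) ∧ HasPolynomialGrowth (component k W) →
      IsAcyclic (graph W) ∧ IsTournament (graph W) := fun ⟨h, h'⟩ =>
    have hA := isAcyclic_of_hasFiniteGlobalDimension h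
    ⟨hA, isTournament_of_acyclic hA (total_of_hasPolynomialGrowth h' hA.irrefl)⟩
  have h47 : IsAcyclic (graph W) ∧ IsTournament (graph W) →
      ∃ y : Equiv.Perm (Fin n), (W : Set (Fin n × Fin n)) =
        {p | ∃ i j : Fin n, i < j ∧ p = (y j, y i)} := fun ⟨hA, hT⟩ =>
    exists_perm_of_tournament hA.irrefl (fun _ _ => hA.asymm)
      (fun x y hxy => (hT.2 x y hxy).or) fun _ _ _ => hA.no_triangle
  refine ⟨?_, fun h => ?_⟩
  · tfae_have 1 → 4 := h14
    tfae_have 4 → 7 := h47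
    tfae_have 2 → 4 := fun ⟨h, hc⟩ =>
      have hA := isAcyclic_of_hasFiniteGlobalDimension h
      ⟨hA, isTournament_of_acyclic hA fun _ _ =>
        total_of_card hA.irrefl (fun _ _ => hA.asymm) hc⟩
    tfae_have 3 → 7 := by
      rintro ⟨h, hd, hc⟩
      have hirr : ∀ x, (x, x) ∉ W := fun x hx => by
        have : (x, x) ∈ W ∩ Finset.diag Finset.univ := by simp [hx]
        rw [hd] at this
        exact absurd this (Finset.notMem_empty _)
      have htot := total_of_hasPolynomialGrowth h hirr
      have hasymm : ∀ x y, (x, y) ∈ W → (y, x) ∉ W := fun _ _ => asymm_of_card hirr htot hc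
      refine exists_perm_of_tournament hirr hasymm htot fun x y z hxy hyz hzx => ?_
      -- By asymmetry, a triangle of `W` traversed backwards lies in the complement.
      have := eq_of_hasPolynomialGrowth W k h (hirr x) (hasymm _ _ hzx) (hasymm _ _ hyz)
        (hasymm _ _ hxy)
      obtain ⟨rfl, -⟩ := this
      exact hirr _ hzx
    tfae_have 7 → 6 := fun ⟨y, hy⟩ => ⟨y, normalWords_eq_of_eq hy⟩
    tfae_have 6 → 5 := by
      rintro ⟨y, hy⟩
      rw [← mk_multichoose, hilbertSeries]
      congr 1
      funext i
      rw [finrank_component, normalCount_eq_multichoose hy]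
    tfae_have 5 → 4 := by
      intro h
      simp only [hilbertSeries, finrank_component] at h
      obtain ⟨h0, hc⟩ := mixedCount_of_hilbert W h
      have hA := isAcyclic_of_no_walk (not_walk_of_mixedCount_eq_zero W h0)
      exact ⟨hA, isTournament_of_acyclic hA fun _ _ =>
        total_of_card hA.irrefl (fun _ _ => hA.asymm) hc⟩
    tfae_have 7 → 1 := fun ⟨y, hy⟩ =>
      ⟨hasFiniteGlobalDimension_of_eq hy, hasPolynomialGrowth_of_eq hy⟩
    tfae_have 7 → 2 := fun ⟨y, hy⟩ => ⟨hasFiniteGlobalDimension_of_eq hy, card_of_eq hy⟩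
    tfae_have 7 → 3 := by
      rintro ⟨y, hy⟩
      refine ⟨hasPolynomialGrowth_of_eq hy, ?_, card_of_eq hy⟩
      ext ⟨a, b⟩
      simp only [Finset.mem_inter, Finset.mem_diag, Finset.mem_univ, true_and,
        Finset.notMem_empty, iff_false, not_and]
      rintro hab rfl
      exact (isAcyclic_of_eq hy).irrefl _ hab
    tfae_finish
  · obtain ⟨y, hy⟩ := h47 (h14 h)
    exact ⟨globalDimension_of_eq hy, hasPolynomialGrowthOfDegree_of_eq hy⟩
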